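/- **Setting.** Consider a closed oriented polygonal mesh with finitely many vertices $j$, edges $e$ and cells $i$, each edge having two distinct end vertices and two distinct adjacent cells. Each cell contains a dual vertex (its centre), each vertex $j$ lies in a dual cell, and each edge $e$ meets its dual edge (joining the centres of the two adjacent cells) in a point $x_e$. The surface consists of the nondegenerate plane triangles in $\mathbb R^3$ with corners (vertex, $x_e$, cell centre); an $n$-gon, primal or dual, is made of $2n$ of them. Let $\mathbf k$ be the unit normal given by the orientation, $\mathbf u^\perp=\mathbf k\times\mathbf u$, and $\langle\cdot,\cdot\rangle$ the $L^2$ inner product on the surface. Each edge carries a unit normal $\mathbf n$ and tangent $\mathbf t=\mathbf k\times\mathbf n$. Let $n_{ei}=1$ ($-1$, $0$) if $\mathbf n$ points out of cell $i$ (into it, otherwise), $t_{ej}=1$ ($-1$, $0$) if $\mathbf t$ points towards vertex $j$ (away from it, otherwise), and $(D_2)_{ie}=n_{ei}$, $(D_1)_{ej}=t_{ej}$, $\overline D_1=-D_2^T$, $\overline D_2=D_1^T$. **Basis functions** (compound P1-RT0-P0 elements and their duals). $\alpha_i$ (resp. $\beta_j$) is constant on cell $i$ (resp. dual cell $j$)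 with integral $1$, and zero elsewhere. $\gamma_j$ is continuous and piecewise linear on the triangles, equal to $1$ at vertex $j$ and $0$ at the other vertices, linear in arc length along each edge, and discretely harmonic in each cell ($\langle\nabla\lambda,\nabla\gamma_j\rangle=0$, where $\lambda$ is the piecewise linear function equal to $1$ at the cell centre and $0$ on the cell boundary). $\mathbf v_e$ is a lowest-order Raviart–Thomas field on the triangles with continuous normal component; its normal component is constant along each edge, with flux $1$ through $e$ in the direction $\mathbf n$ and $0$ through the other edges; its divergence is constant on each cell; and it is weakly curl-free on each cell, $\langle\nabla^\perp\lambda,\mathbf v_e\rangle=0$. $\mathbf w_e=\mathbf k\times\mathbf r_e$, where $\mathbf r_e$ is the field constructed in the same way on the dual mesh, normalised so that $\mathbf w_e$ has circulation $1$ along the dual edge of $e$, in the sense of $\mathbf n$, and $0$ along the other dual edges. **Matrices.** $L_{ii'}=\langle\alpha_i,\alpha_{i'}\rangle$, $M_{ee'}=\langle\mathbf v_e,\mathbf v_{e'}\rangle$, $N_{jj'}=\langle\gamma_j,\gamma_{j'}\rangle$, $R_{ji}=\langle\gamma_j,\alpha_i\rangle$, $W_{ee'}=-\langle\mathbf v_e,\mathbf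 v_{e'}^\perp\rangle$, $H_{ee'}=\langle\mathbf v_e,\mathbf w_{e'}\rangle$, $J_{jj'}=\langle\gamma_j,\beta_{j'}\rangle$. Assume that $J$ is invertible. **Scheme.** Let $\mathrm{adv}_1,\mathrm{adv}_2$ be arbitrary maps (the advection operators), and let $\Phi_{\rm orog}$ (in the basis $\alpha_i$) and the Coriolis field $f=\sum_j f_j\beta_j$ be independent of time. Suppose that on a set $I$ of times (typically an interval; derivatives are taken within $I$) the coefficient vectors satisfy $$\dot\Phi+D_2F=0,\qquad M\dot U+MQ^\perp+\overline D_1L(\Phi+\Phi_{\rm orog}+K)=0,$$ with $K_i=\tfrac12\int_{\mathrm{cell}\ i}|\mathbf u|^2dA$, $\mathbf u=\sum_eU_e\mathbf v_e$, $F=\mathrm{adv}_1(U,\Phi)$. Let the dual mass flux $\widehat{F^\perp}$ satisfy $H\widehat{F^\perp}=-WF$, let the dual mass field $\bar\phi=\sum_j\bar\Phi_j\beta_j$ be given by $J\bar\Phi=R\Phi$, and let the vorticity be given by $N\Xi=\overline D_2MU$, $J\hat\Xi=N\Xi$, $\hat\xi=\sum_j\hat\Xi_j\beta_j$. Let the potential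 vorticity $\pi=\sum_j\Pi_j\beta_j$ satisfy $\pi\bar\phi=f+\hat\xi$ (that is, $\pi=(f+\hat\xi)/\bar\phi$ where $\bar\phi\neq0$), and let $\widehat{Q^\perp}=\mathrm{adv}_2(\widehat{F^\perp},\Pi)$ and $H\widehat{Q^\perp}=MQ^\perp$. **Claim.** At all times in $I$, $\bar\Phi$ and $\hat\Xi$ are differentiable and $$\dot{\bar\Phi}+\overline D_2\widehat{F^\perp}=0,\qquad \dot{\hat\Xi}+\overline D_2\widehat{Q^\perp}=0 .$$ Consequently dual mass and PV obey consistent finite-volume equations on the dual mesh: for every dual cell $j$, $$\frac{d}{dt}\int_{\text{dual cell }j}\bar\phi\,dA=-\sum_et_{ej}\,\widehat{F^\perp}_e,\qquad \frac{d}{dt}\int_{\text{dual cell }j}\pi\bar\phi\,dA=-\sum_et_{ej}\,\mathrm{adv}_2(\widehat{F^\perp},\Pi)_e .$$ -/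

import Mathlib

open MeasureTheory
open scoped Matrix

noncomputable section

/-! ### Closed polygonal meshes and their triangular supermesh -/

/-- A subtriangle `(e, h, l)` of the supermesh: its corners are the end `h` of the edge `e`
(`true` is the end that the unit tangent `t` points towards), the point where `e` meets its dual
edge, and the centre of the cell on side `l` of `e` (`true` is the left of `t`, that is, the side
from which the unit normal `n` points away, as `t = k × n`). -/
abbrev SubTri (E : Type*) := E × Bool × Bool

namespace SubTri

/-- The neighbour across the side opposite the primal vertex (same edge, same cell). -/
def flipVert {E : Type*} (T : SubTri E) : SubTri E := (T.1, !T.2.1, T.2.2)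

/-- The neighbour across the side opposite the cell centre (same edge, same vertex). -/
def flipCell {E : Type*} (T : SubTri E) : SubTri E := (T.1, T.2.1, !T.2.2)

end SubTri

/-- A closed oriented polygonal mesh with vertices `V`, edges `E` and cells `C`, together with its
dual mesh, realised as a surface made of planar triangular facets in `ℝ³`.  The cell `i` has the
dual vertex `posC i` as its centre, and the edge `e` and its dual edge meet in `posE e`: the primal
edge is the broken line vertex - `posE e` - vertex and the dual edge is the broken line
centre - `posE e` - centre.  The involution `turn` sends a subtriangle to the one on the other side
of the segment that joins its primal vertex to its cell centre. -/
structure PolygonalMesh (V E C : Type*) where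
  vert : E → Bool → V
  cell : E → Bool → C
  turn : SubTri E → SubTri E
  turn_turn : ∀ T, turn (turn T) = T
  vert_turn : ∀ T, vert (turn T).1 (turn T).2.1 = vert T.1 T.2.1
  cell_turn : ∀ T, cell (turn T).1 (turn T).2.2 = cell T.1 T.2.2
  /-- crossing a side reverses the cyclic order of (vertex, edge point, centre): orientability -/
  orient_turn : ∀ T, xor (turn T).2.1 (turn T).2.2 = !(xor T.2.1 T.2.2)
  vert_ne : ∀ e, vert e true ≠ vert e false
  cell_ne : ∀ e, cell e true ≠ cell e false
  vert_surj : ∀ j, ∃ e h, vert e h = j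
  cell_surj : ∀ i, ∃ e l, cell e l = i
  /-- the subtriangles of a primal cell form one cycle around its centre -/
  cell_cycle : ∀ T T' : SubTri E, cell T.1 T.2.2 = cell T'.1 T'.2.2 →
    Relation.EqvGen (fun S S' => S' = S.flipVert ∨ S' = turn S) T T'
  /-- the subtriangles around a primal vertex form one cycle, the dual cell -/
  vert_cycle : ∀ T T' : SubTri E, vert T.1 T.2.1 = vert T'.1 T'.2.1 →
    Relation.EqvGen (fun S S' => S' = turn S ∨ S' = S.flipCell) T T'
  posV : V → Fin 3 → ℝ
  posE : E → Fin 3 → ℝ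
  posC : C → Fin 3 → ℝ
  nondeg : ∀ T : SubTri E, (posE T.1 - posV (vert T.1 T.2.1)) ⨯₃
    (posC (cell T.1 T.2.2) - posV (vert T.1 T.2.1)) ≠ 0

/-- Euclidean length of a vector of `ℝ³`. -/
def len3 (u : Fin 3 → ℝ) : ℝ := √(u ⬝ᵥ u)

/-- The sign `1` for `true` and `-1` for `false`. -/
def bsign (b : Bool) : ℝ := if b then 1 else -1

/-- The reference triangle, which parametrises every facet affinely. -/
def refTri : Set (ℝ × ℝ) := {p | 0 ≤ p.1 ∧ 0 ≤ p.2 ∧ p.1 + p.2 ≤ 1}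

/-- Barycentric coordinates of a point of the reference triangle. -/
def bary (p : ℝ × ℝ) : Fin 3 → ℝ := ![1 - p.1 - p.2, p.1, p.2]

namespace PolygonalMesh

variable {V E C : Type*} (m : PolygonalMesh V E C)

/-! ### Geometry of the facets -/

/-- The primal vertex of a subtriangle, which labels its dual cell. -/
def vertOf (T : SubTri E) : V := m.vert T.1 T.2.1

/-- The primal cell of a subtriangle. -/
def cellOf (T : SubTri E) : C := m.cell T.1 T.2.2

/-- The corners of a subtriangle: 0 is the primal vertex, 1 the edge point, 2 the cell centre. -/
def corner (T : SubTri E) : Fin 3 → Fin 3 → ℝ :=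
  ![m.posV (m.vertOf T), m.posE T.1, m.posC (m.cellOf T)]

/-- The neighbour of a subtriangle across the side opposite corner `k`. -/
def adj (k : Fin 3) (T : SubTri E) : SubTri E := ![T.flipVert, m.turn T, T.flipCell] k

/-- A (non-unit) normal of a facet. -/
def nvec (T : SubTri E) : Fin 3 → ℝ :=
  (m.corner T 1 - m.corner T 0) ⨯₃ (m.corner T 2 - m.corner T 0)

/-- The area of a facet. -/
def area (T : SubTri E) : ℝ := len3 (m.nvec T) / 2

/-- `1` if (vertex, edge point, centre) is the counterclockwise order of the corners,
`-1` otherwise. -/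
def orient (T : SubTri E) : ℝ := if xor T.2.1 T.2.2 then 1 else -1

/-- The unit normal `k` of a facet, on the side from which the orientation is counterclockwise. -/
def kvec (T : SubTri E) : Fin 3 → ℝ := (orient T / len3 (m.nvec T)) • m.nvec T

/-- `u ↦ k × u` on a facet. -/
def perp (T : SubTri E) (u : Fin 3 → ℝ) : Fin 3 → ℝ := m.kvec T ⨯₃ u

/-- The point of a facet with given reference coordinates. -/
def pt (T : SubTri E) (p : ℝ × ℝ) : Fin 3 → ℝ := ∑ k, bary p k • m.corner T k

/-- The integral `∫ f dA` over one facet, by the affine parametrisation. -/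
def facetInt (T : SubTri E) (f : ℝ × ℝ → ℝ) : ℝ := 2 * m.area T * ∫ p in refTri, f p

/-- The integral over the part of the surface made of the facets in `S`. -/
def intOver (S : Finset (SubTri E)) (f : SubTri E → ℝ × ℝ → ℝ) : ℝ := ∑ T ∈ S, m.facetInt T (f T)

/-- The facets that make up a primal cell. -/
def cellTris [Fintype E] [DecidableEq C] (i : C) : Finset (SubTri E) := {T | m.cellOf T = i}

/-- The facets that make up a dual cell. -/
def dualTris [Fintype E] [DecidableEq V] (j : V) : Finset (SubTri E) := {T | m.vertOf T = j}

/-! ### Lowest order finite elements on the facets -/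

/-- The continuous piecewise linear function with corner values `g`. -/
def p1 (g : SubTri E → Fin 3 → ℝ) (T : SubTri E) (p : ℝ × ℝ) : ℝ := ∑ k, bary p k * g T k

/-- The surface gradient of the barycentric coordinate of corner `k`. -/
def gradBary (T : SubTri E) (k : Fin 3) : Fin 3 → ℝ :=
  (len3 (m.nvec T) ^ 2)⁻¹ • (m.nvec T ⨯₃ (m.corner T (k + 2) - m.corner T (k + 1)))

/-- The surface gradient of `p1 g` on a facet. -/
def gradP1 (g : SubTri E → Fin 3 → ℝ) (T : SubTri E) : Fin 3 → ℝ := ∑ k, g T k • m.gradBary T k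

/-- The lowest order Raviart-Thomas field whose flux out of the facet `T` through the side
opposite corner `k` is `f T k`. -/
def rt0 (f : SubTri E → Fin 3 → ℝ) (T : SubTri E) (p : ℝ × ℝ) : Fin 3 → ℝ :=
  ∑ k, (f T k / (2 * m.area T)) • (m.pt T p - m.corner T k)

/-- The divergence of `rt0 f` on a facet. -/
def divRT0 (f : SubTri E → Fin 3 → ℝ) (T : SubTri E) : ℝ := (∑ k, f T k) / m.area T

/-- Discrete harmonic extension of normal fluxes into compound elements.  The subtriangles are
grouped by `elem` into compound elements whose centre is corner `o`; `b` prescribes the fluxes out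
of the compound elements.  The field is Raviart-Thomas on the supermesh with continuous normal
component, its divergence is constant on each compound element, and its curl vanishes weakly: it is
orthogonal to `k × ∇` of the piecewise linear function that is 1 at the centre and vanishes on the
boundary of the element. -/
structure IsCompoundRT0 [Fintype E] {κ : Type*} [DecidableEq κ] (o : Fin 3)
    (elem : SubTri E → κ) (b : SubTri E → ℝ) (f : SubTri E → Fin 3 → ℝ) : Prop where
  normal_cont : ∀ k T, f (m.adj k T) k = -f T k
  boundary : ∀ T, f T o = b T
  div_const : ∀ T T', elem T = elem T' → m.divRT0 f T = m.divRT0 f T'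
  weak_curl : ∀ i, m.intOver {T | elem T = i}
    (fun T p => m.perp T (m.gradBary T o) ⬝ᵥ m.rt0 f T p) = 0

/-- Length of the half of the primal edge `e` that ends at its end `h`. -/
def halfP (e : E) (h : Bool) : ℝ := len3 (m.posV (m.vert e h) - m.posE e)

/-- Length of the half of the dual edge of `e` that ends at the centre on side `l`. -/
def halfD (e : E) (l : Bool) : ℝ := len3 (m.posC (m.cell e l) - m.posE e)

/-- Boundary fluxes of the velocity basis function of `e`: flux 1 through `e` along `n`, that is,
out of the left cell, with constant normal component along `e`; flux 0 through other edges. -/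
def vFlux [DecidableEq E] (e : E) (T : SubTri E) : ℝ :=
  if T.1 = e then bsign T.2.2 * (m.halfP e T.2.1 / (m.halfP e true + m.halfP e false)) else 0

/-- Boundary fluxes of the field `r` such that `k × r` is the dual basis function of `e`: the
circulation of `k × r` along the dual edge, from the left to the right of `e`, is 1, that is, `r`
has flux 1 out of the dual cell of the vertex that `t` points towards. -/
def wFlux [DecidableEq E] (e : E) (T : SubTri E) : ℝ :=
  if T.1 = e then bsign T.2.1 * (m.halfD e T.2.2 / (m.halfD e true + m.halfD e false)) else 0

/-- Corner values of a piecewise linear function that is 1 at the vertex `j`, 0 at other vertices,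
linear in arc length along the primal edges, and has the value `c i` at the centre of cell `i`. -/
def hatVals [DecidableEq V] (j : V) (c : C → ℝ) (T : SubTri E) : Fin 3 → ℝ :=
  ![if m.vertOf T = j then 1 else 0,
    ∑ h : Bool, (if m.vert T.1 h = j then
      m.halfP T.1 (!h) / (m.halfP T.1 true + m.halfP T.1 false) else 0),
    c (m.cellOf T)]

/-! ### Existence of the compound basis functions -/

theorem exists_flow {F κ : Type*} [Fintype F] [DecidableEq κ] (a b : F → F)
    (elem : F → κ)
    (hab : ∀ T T', elem T = elem T' → Relation.EqvGen (fun S S' => S' = a S ∨ S' = b S) T T')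
    (ha : ∀ T, a (a T) = T) (hb : ∀ T, b (b T) = T)
    (g : F → ℝ) (hg : ∀ i, ∑ T with elem T = i, g T = 0) :
    ∃ x y : F → ℝ, (∀ T, x (a T) = -x T) ∧ (∀ T, y (b T) = -y T) ∧ ∀ T, x T + y T = g T := by
  classical
  let A : ((F → ℝ) × (F → ℝ)) →ₗ[ℝ] (F → ℝ) :=
    { toFun := fun z T => (z.1 T - z.1 (a T)) + (z.2 T - z.2 (b T))
      map_add' := by intro z w; ext T; simp; ring
      map_smul' := by intro c z; ext T; simp; ring }
  by_cases hgA : g ∈ LinearMap.range A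
  · obtain ⟨⟨z, w⟩, h⟩ := hgA
    refine ⟨fun T => z T - z (a T), fun T => w T - w (b T), fun T => ?_, fun T => ?_, fun T => ?_⟩
    · simp [ha]
    · simp [hb]
    · exact congrFun h T
  exfalso
  obtain ⟨φ, hφ, hle⟩ := Submodule.exists_le_ker_of_notMem hgA
  have key : ∀ z w : F → ℝ, φ (fun T => (z T - z (a T)) + (w T - w (b T))) = 0 :=
    fun z w => hle ⟨(z, w), rfl⟩
  have hrep : ∀ v : F → ℝ, φ v = ∑ T, v T * φ (Pi.single T 1) := by
    intro v
    rw [LinearMap.pi_apply_eq_sum_univ φ v]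
    refine Finset.sum_congr rfl fun T _ => ?_
    rw [smul_eq_mul]; congr 2; ext j; simp [Pi.single_apply, eq_comm]
  set h : F → ℝ := fun T => φ (Pi.single T 1) with hh
  have hsa : ∀ T, h (a T) = h T := by
    intro T
    have := key (Pi.single T 1) 0
    have e : (fun S => ((Pi.single T 1 : F → ℝ) S - (Pi.single T 1 : F → ℝ) (a S)) +
        ((0 : F → ℝ) S - (0 : F → ℝ) (b S))) = Pi.single T 1 - Pi.single (a T) 1 := by
      ext S
      have : a S = T ↔ S = a T := ⟨fun h => by rw [← h, ha], fun h => by rw [h, ha]⟩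
      simp [Pi.single_apply, this]
    rw [e, map_sub] at this
    simp only [hh]; linarith
  have hsb : ∀ T, h (b T) = h T := by
    intro T
    have := key 0 (Pi.single T 1)
    have e : (fun S => ((0 : F → ℝ) S - (0 : F → ℝ) (a S)) +
        ((Pi.single T 1 : F → ℝ) S - (Pi.single T 1 : F → ℝ) (b S))) =
        Pi.single T 1 - Pi.single (b T) 1 := by
      ext S
      have : b S = T ↔ S = b T := ⟨fun h => by rw [← h, hb], fun h => by rw [h, hb]⟩
      simp [Pi.single_apply, this]
    rw [e, map_sub] at this
    simp only [hh]; linarith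
  have hconst : ∀ T T', elem T = elem T' → h T = h T' := by
    intro T T' he
    have gen : ∀ S S', Relation.EqvGen (fun S S' => S' = a S ∨ S' = b S) S S' → h S = h S' := by
      intro S S' hS
      induction hS with
      | rel x y hxy => rcases hxy with rfl | rfl <;> simp [hsa, hsb]
      | refl x => rfl
      | symm x y _ ih => exact ih.symm
      | trans x y z _ _ ih1 ih2 => exact ih1.trans ih2
    exact gen T T' (hab T T' he)
  apply hφ
  rw [hrep g]
  rw [← Finset.sum_fiberwise_of_maps_to (s := Finset.univ) (t := Finset.univ.image elem) (g := elem)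
    (fun T _ => Finset.mem_image_of_mem _ (Finset.mem_univ T))]
  refine Finset.sum_eq_zero fun i hi => ?_
  obtain ⟨T0, -, hT0⟩ := Finset.mem_image.1 hi
  rw [Finset.sum_congr rfl (g := fun T => g T * h T0), ← Finset.sum_mul, hg, zero_mul]
  intro T hT
  show g T * h T = g T * h T0
  rw [hconst T T0]
  rw [(Finset.mem_filter.1 hT).2, hT0]

theorem flipVert_flipVert (T : SubTri E) : T.flipVert.flipVert = T := by
  simp [SubTri.flipVert]

theorem flipCell_flipCell (T : SubTri E) : T.flipCell.flipCell = T := by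
  simp [SubTri.flipCell]

theorem adj_adj (k : Fin 3) (T : SubTri E) : m.adj k (m.adj k T) = T := by
  fin_cases k
  · exact flipVert_flipVert T
  · exact m.turn_turn T
  · exact flipCell_flipCell T

theorem orient_adj (k : Fin 3) (T : SubTri E) : orient (m.adj k T) = -orient T := by
  have h1 := m.orient_turn T
  rcases T with ⟨e, h, l⟩
  fin_cases k
  · cases h <;> cases l <;> simp [adj, orient, SubTri.flipVert]
  · show orient (m.turn (e, h, l)) = _
    unfold orient
    rw [h1]
    cases h <;> cases l <;> simp
  · cases h <;> cases l <;> simp [adj, orient, SubTri.flipCell]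

theorem orient_mul_self (T : SubTri E) : orient T * orient T = 1 := by
  unfold orient; split_ifs <;> norm_num

theorem dot_self_nonneg (u : Fin 3 → ℝ) : 0 ≤ u ⬝ᵥ u :=
  Finset.sum_nonneg fun i _ => mul_self_nonneg (u i)

theorem len3_sq (u : Fin 3 → ℝ) : len3 u ^ 2 = u ⬝ᵥ u := Real.sq_sqrt (dot_self_nonneg u)

theorem len3_pos {u : Fin 3 → ℝ} (hu : u ≠ 0) : 0 < len3 u :=
  Real.sqrt_pos.2 ((dot_self_nonneg u).lt_of_ne fun h => hu (dotProduct_self_eq_zero.1 h.symm))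

theorem nvec_ne (T : SubTri E) : m.nvec T ≠ 0 := m.nondeg T

theorem area_pos (T : SubTri E) : 0 < m.area T := half_pos (len3_pos (m.nvec_ne T))

/-- The side opposite corner `o`. -/
def side (T : SubTri E) (o : Fin 3) : Fin 3 → ℝ := m.corner T (o + 2) - m.corner T (o + 1)

theorem nvec_dot_side (T : SubTri E) (o : Fin 3) : m.nvec T ⬝ᵥ m.side T o = 0 := by
  fin_cases o <;> simp [side, nvec, cross_apply, dotProduct, Fin.sum_univ_three] <;> ring

theorem side_ne (T : SubTri E) (o : Fin 3) : m.side T o ≠ 0 := by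
  intro h
  apply m.nvec_ne T
  fin_cases o
  · have h' : m.corner T 2 = m.corner T 1 := sub_eq_zero.1 h
    simp [nvec, h']
  · have h' : m.corner T 0 = m.corner T 2 := sub_eq_zero.1 h
    simp [nvec, h']
  · have h' : m.corner T 1 = m.corner T 0 := sub_eq_zero.1 h
    simp [nvec, h']

theorem side_dot_pos (T : SubTri E) (o : Fin 3) : 0 < m.side T o ⬝ᵥ m.side T o :=
  (dot_self_nonneg _).lt_of_ne fun h => m.side_ne T o (dotProduct_self_eq_zero.1 h.symm)

theorem perp_gradBary (T : SubTri E) (o : Fin 3) :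
    m.perp T (m.gradBary T o) = (-(orient T / len3 (m.nvec T))) • m.side T o := by
  have hl := (len3_pos (m.nvec_ne T)).ne'
  have h1 := m.nvec_dot_side T o
  have h2 := len3_sq (m.nvec T)
  unfold perp kvec gradBary
  change ((orient T / len3 (m.nvec T)) • m.nvec T) ⨯₃
    ((len3 (m.nvec T) ^ 2)⁻¹ • (m.nvec T ⨯₃ m.side T o)) = _
  rw [map_smul, map_smul, LinearMap.smul_apply, cross_cross_eq_smul_sub_smul', h1, ← h2, zero_smul,
    zero_sub]
  ext i
  simp only [Pi.smul_apply, Pi.neg_apply, smul_eq_mul]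
  field_simp

theorem isCompact_refTri : IsCompact refTri := by
  apply Metric.isCompact_of_isClosed_isBounded
  · exact (isClosed_le continuous_const continuous_fst).inter
      ((isClosed_le continuous_const continuous_snd).inter
        (isClosed_le (continuous_fst.add continuous_snd) continuous_const))
  · refine (Metric.isBounded_Icc (0 : ℝ × ℝ) (1, 1)).subset ?_
    rintro ⟨x, y⟩ ⟨h1, h2, h3⟩
    simp only at h1 h2 h3
    exact ⟨⟨h1, h2⟩, ⟨by linarith, by linarith⟩⟩

theorem refTri_pos : 0 < (volume refTri).toReal := by
  apply ENNReal.toReal_pos _ isCompact_refTri.measure_lt_top.ne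
  have hU : IsOpen {p : ℝ × ℝ | 0 < p.1 ∧ 0 < p.2 ∧ p.1 + p.2 < 1} :=
    (isOpen_lt continuous_const continuous_fst).inter
      ((isOpen_lt continuous_const continuous_snd).inter
        (isOpen_lt (continuous_fst.add continuous_snd) continuous_const))
  have hmem : ((1 / 4 : ℝ), (1 / 4 : ℝ)) ∈ {p : ℝ × ℝ | 0 < p.1 ∧ 0 < p.2 ∧ p.1 + p.2 < 1} := by
    refine ⟨?_, ?_, ?_⟩ <;> norm_num
  have hpos := hU.measure_pos (volume : Measure (ℝ × ℝ)) ⟨_, hmem⟩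
  have hsub : {p : ℝ × ℝ | 0 < p.1 ∧ 0 < p.2 ∧ p.1 + p.2 < 1} ⊆ refTri :=
    fun p (hp : 0 < p.1 ∧ 0 < p.2 ∧ p.1 + p.2 < 1) =>
      (⟨hp.1.le, hp.2.1.le, hp.2.2.le⟩ : 0 ≤ p.1 ∧ 0 ≤ p.2 ∧ p.1 + p.2 ≤ 1)
  exact (hpos.trans_le (measure_mono hsub)).ne'

theorem continuous_rt0_dot (a : Fin 3 → ℝ) (f : SubTri E → Fin 3 → ℝ) (T : SubTri E) :
    Continuous fun p => a ⬝ᵥ m.rt0 f T p := by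
  have h : ∀ k, Continuous fun p => bary p k := by
    intro k; fin_cases k <;> simp [bary] <;> fun_prop
  have h' : ∀ i, Continuous fun p => m.rt0 f T p i := by
    intro i
    simp only [rt0, pt, Finset.sum_apply, Pi.smul_apply, Pi.sub_apply, smul_eq_mul]
    fun_prop
  unfold dotProduct
  fun_prop

theorem exists_isCompoundRT0 [Fintype E] {κ : Type*} [DecidableEq κ] (o : Fin 3)
    (elem : SubTri E → κ) (b : SubTri E → ℝ)
    (h1 : ∀ T, elem (m.adj (o + 1) T) = elem T) (h2 : ∀ T, elem (m.adj (o + 2) T) = elem T)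
    (hab : ∀ T T', elem T = elem T' →
      Relation.EqvGen (fun S S' => S' = m.adj (o + 1) S ∨ S' = m.adj (o + 2) S) T T')
    (hb : ∀ T, b (m.adj o T) = -b T) : ∃ f, m.IsCompoundRT0 o elem b f := by
  classical
  let S : κ → Finset (SubTri E) := fun i => {T | elem T = i}
  let c : κ → ℝ := fun i => (∑ T ∈ S i, b T) / ∑ T ∈ S i, m.area T
  have hA : ∀ T, 0 < ∑ T' ∈ S (elem T), m.area T' := fun T =>
    Finset.sum_pos (fun T' _ => m.area_pos T') ⟨T, by simp [S]⟩
  obtain ⟨x, y, hx, hy, hxy⟩ := exists_flow (m.adj (o + 1)) (m.adj (o + 2)) elem hab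
    (m.adj_adj _) (m.adj_adj _) (fun T => c (elem T) * m.area T - b T) (by
      intro i
      by_cases hi : ∃ T, elem T = i
      · obtain ⟨T, rfl⟩ := hi
        rw [Finset.sum_sub_distrib, Finset.sum_congr rfl (g := fun T' => c (elem T) * m.area T'),
          ← Finset.mul_sum]
        · show (∑ T ∈ S (elem T), b T) / (∑ T' ∈ S (elem T), m.area T') *
            (∑ T' ∈ S (elem T), m.area T') - ∑ T ∈ S (elem T), b T = 0
          rw [div_mul_cancel₀ _ (hA T).ne', sub_self]
        · intro T' hT'
          rw [(Finset.mem_filter.1 hT').2]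
      · apply Finset.sum_eq_zero
        intro T hT
        exact absurd ⟨T, (Finset.mem_filter.1 hT).2⟩ hi)
  -- the flux field, up to a circulation `z` around each centre
  let f : (κ → ℝ) → SubTri E → Fin 3 → ℝ := fun z T k =>
    if k = o then b T else if k = o + 1 then x T + z (elem T) * orient T
      else y T - z (elem T) * orient T
  have ho1 : o + 1 ≠ o := by fin_cases o <;> decide
  have ho2 : o + 2 ≠ o := by fin_cases o <;> decide
  have ho3 : o + 2 ≠ o + 1 := by fin_cases o <;> decide
  have hcases : ∀ k : Fin 3, k = o ∨ k = o + 1 ∨ k = o + 2 := by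
    intro k; fin_cases o <;> fin_cases k <;> decide
  have hsum : ∀ u : Fin 3 → ℝ, ∑ k, u k = u o + u (o + 1) + u (o + 2) := by
    intro u; rw [Fin.sum_univ_three]; fin_cases o <;> simp <;> ring
  have hsumv : ∀ u : Fin 3 → Fin 3 → ℝ, ∑ k, u k = u o + u (o + 1) + u (o + 2) := by
    intro u; rw [Fin.sum_univ_three]; fin_cases o <;> simp <;> abel
  have hrt : ∀ z T p, m.rt0 (f z) T p = m.rt0 (f 0) T p +
      (z (elem T) * orient T / (2 * m.area T)) • m.side T o := by
    intro z T p
    unfold rt0 side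
    rw [hsumv, hsumv]
    simp only [f, if_true, ho1, ho2, ho3, if_false, Pi.zero_apply, zero_mul, add_zero, sub_zero]
    ext i
    simp only [Pi.add_apply, Pi.smul_apply, Pi.sub_apply, smul_eq_mul]
    ring
  let I0 : κ → ℝ := fun i => m.intOver (S i) fun T p =>
    m.perp T (m.gradBary T o) ⬝ᵥ m.rt0 (f 0) T p
  let I1 : κ → ℝ := fun i => ∑ T ∈ S i, (m.side T o ⬝ᵥ m.side T o) / len3 (m.nvec T) *
    (volume refTri).toReal
  have hint : ∀ z i, m.intOver (S i) (fun T p => m.perp T (m.gradBary T o) ⬝ᵥ m.rt0 (f z) T p) =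
      I0 i - z i * I1 i := by
    intro z i
    simp only [I0, I1, intOver]
    rw [Finset.mul_sum, ← Finset.sum_sub_distrib]
    refine Finset.sum_congr rfl fun T hT => ?_
    have hTi : elem T = i := (Finset.mem_filter.1 hT).2
    have hl := len3_pos (m.nvec_ne T)
    have e1 : ∀ p, m.perp T (m.gradBary T o) ⬝ᵥ m.rt0 (f z) T p =
        m.perp T (m.gradBary T o) ⬝ᵥ m.rt0 (f 0) T p -
          z i * (m.side T o ⬝ᵥ m.side T o) / len3 (m.nvec T) ^ 2 := by
      intro p
      rw [hrt z T p, dotProduct_add, perp_gradBary, hTi, smul_dotProduct, smul_dotProduct,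
        dotProduct_smul]
      have e3 : 2 * m.area T = len3 (m.nvec T) := by unfold area; ring
      have e4 := orient_mul_self T
      rw [e3]
      simp only [smul_eq_mul]
      field_simp
      linear_combination (-(z i * (m.side T o ⬝ᵥ m.side T o))) * e4
    unfold facetInt
    simp only [e1]
    rw [integral_sub
      ((m.continuous_rt0_dot _ _ T).continuousOn.integrableOn_compact isCompact_refTri)
      (continuous_const.continuousOn.integrableOn_compact isCompact_refTri), setIntegral_const]
    have e3 : 2 * m.area T = len3 (m.nvec T) := by unfold area; ring
    rw [e3, smul_eq_mul]
    simp only [Measure.real]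
    field_simp
  have hI1 : ∀ T, 0 < I1 (elem T) := fun T =>
    Finset.sum_pos (fun T' _ => mul_pos (div_pos (m.side_dot_pos T' o)
      (len3_pos (m.nvec_ne T'))) refTri_pos) ⟨T, by simp [S]⟩
  refine ⟨f (fun i => I0 i / I1 i), ?_, ?_, ?_, ?_⟩
  · intro k T
    rcases hcases k with rfl | rfl | rfl
    · simp [f, hb]
    · simp only [f, if_true, ho1, if_false, hx, h1, orient_adj]; ring
    · simp only [f, ho2, ho3, if_false, hy, h2, orient_adj]; ring
  · intro T; simp [f]
  · have hd : ∀ z T, m.divRT0 (f z) T = c (elem T) := by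
      intro z T
      unfold divRT0
      rw [hsum, div_eq_iff (m.area_pos T).ne']
      simp only [f, if_true, ho1, ho2, ho3, if_false]
      linear_combination hxy T
    intro T T' h
    exact (hd (fun i => I0 i / I1 i) T).trans
      ((congrArg c h).trans (hd (fun i => I0 i / I1 i) T').symm)
  · intro i
    refine (hint (fun i => I0 i / I1 i) i).trans ?_
    show I0 i - I0 i / I1 i * I1 i = 0
    by_cases hi : ∃ T, elem T = i
    · obtain ⟨T, rfl⟩ := hi
      rw [div_mul_cancel₀ _ (hI1 T).ne', sub_self]
    · have : S i = ∅ := by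
        apply Finset.filter_eq_empty_iff.2
        intro T _ hT
        exact hi ⟨T, hT⟩
      simp [I0, I1, intOver, this]

theorem vOf_turn (T : SubTri E) : m.vertOf (m.turn T) = m.vertOf T := m.vert_turn T
theorem cOf_turn (T : SubTri E) : m.cellOf (m.turn T) = m.cellOf T := m.cell_turn T

theorem exists_primal_rt0 [Fintype E] [DecidableEq E] [DecidableEq C] (e : E) :
    ∃ f, m.IsCompoundRT0 2 m.cellOf (m.vFlux e) f := by
  refine m.exists_isCompoundRT0 2 m.cellOf (m.vFlux e) (fun T => rfl) m.cOf_turn m.cell_cycle ?_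
  rintro ⟨e', h, l⟩
  show m.vFlux e (e', h, !l) = - m.vFlux e (e', h, l)
  unfold vFlux
  cases l <;> simp [bsign] <;> split_ifs <;> simp

theorem exists_dual_rt0 [Fintype E] [DecidableEq E] [DecidableEq V] (e : E) :
    ∃ f, m.IsCompoundRT0 0 m.vertOf (m.wFlux e) f := by
  refine m.exists_isCompoundRT0 0 m.vertOf (m.wFlux e) m.vOf_turn (fun T => rfl) m.vert_cycle ?_
  rintro ⟨e', h, l⟩
  show m.wFlux e (e', !h, l) = - m.wFlux e (e', h, l)
  unfold wFlux
  cases h <;> simp [bsign] <;> split_ifs <;> simp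

/-- Discrete harmonicity at the cell centres: on every cell, the gradient of the function is
orthogonal to the gradient of the piecewise linear function that is 1 at the centre and vanishes on
the boundary of the cell. -/
def IsDiscreteHarmonic [Fintype E] [DecidableEq C] (g : SubTri E → Fin 3 → ℝ) : Prop :=
  ∀ i, m.intOver (m.cellTris i) (fun T _ => m.gradBary T 2 ⬝ᵥ m.gradP1 g T) = 0

theorem gradBary_ne (T : SubTri E) (k : Fin 3) : m.gradBary T k ≠ 0 := by
  intro h
  have h1 := m.perp_gradBary T k
  have hl := len3_pos (m.nvec_ne T)
  have ho : orient T ≠ 0 := fun h0 => by simpa [h0] using orient_mul_self T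
  rw [h, perp, map_zero] at h1
  rcases smul_eq_zero.1 h1.symm with h2 | h2
  · exact div_ne_zero ho hl.ne' (neg_eq_zero.1 h2)
  · exact m.side_ne T k h2

theorem exists_hat [Fintype E] [DecidableEq V] [DecidableEq C] (j : V) :
    ∃ c : C → ℝ, m.IsDiscreteHarmonic (m.hatVals j c) := by
  classical
  let w : SubTri E → ℝ := fun T => 2 * m.area T * (volume refTri).toReal
  have hw : ∀ T, 0 < w T := fun T => mul_pos (mul_pos two_pos (m.area_pos T)) refTri_pos
  let N : C → ℝ := fun i => ∑ T ∈ m.cellTris i,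
    w T * (m.gradBary T 2 ⬝ᵥ m.gradP1 (m.hatVals j 0) T)
  let D : C → ℝ := fun i => ∑ T ∈ m.cellTris i, w T * (m.gradBary T 2 ⬝ᵥ m.gradBary T 2)
  have hD : ∀ i, 0 < D i := by
    intro i
    obtain ⟨e, l, h⟩ := m.cell_surj i
    refine Finset.sum_pos (fun T _ => mul_pos (hw T) ((dot_self_nonneg _).lt_of_ne fun h0 =>
      m.gradBary_ne T 2 (dotProduct_self_eq_zero.1 h0.symm))) ⟨(e, true, l), ?_⟩
    exact Finset.mem_filter.2 ⟨Finset.mem_univ _, h⟩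
  refine ⟨fun i => -(N i / D i), fun i => ?_⟩
  have key : m.intOver (m.cellTris i) (fun T _ => m.gradBary T 2 ⬝ᵥ
      m.gradP1 (m.hatVals j fun i => -(N i / D i)) T) = N i + -(N i / D i) * D i := by
    simp only [N, D, intOver]
    rw [Finset.mul_sum, ← Finset.sum_add_distrib]
    refine Finset.sum_congr rfl fun T hT => ?_
    have hTi : m.cellOf T = i := (Finset.mem_filter.1 hT).2
    have e1 : ∀ c : C → ℝ, m.gradP1 (m.hatVals j c) T =
        m.gradP1 (m.hatVals j 0) T + c (m.cellOf T) • m.gradBary T 2 := by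
      intro c
      simp [gradP1, Fin.sum_univ_three, hatVals]
    rw [e1, hTi, dotProduct_add, dotProduct_smul]
    unfold facetInt
    rw [setIntegral_const]
    simp only [w, smul_eq_mul, Measure.real]
    ring
  rw [key, neg_mul, div_mul_cancel₀ _ (hD i).ne', add_neg_cancel]

/-! ### Basis functions -/

section Basis

variable [Fintype V] [Fintype E] [Fintype C] [DecidableEq V] [DecidableEq E] [DecidableEq C]

/-- The basis function `α i` of `V₂`: constant on the cell `i` with integral 1, 0 elsewhere. -/
def alpha (i : C) (T : SubTri E) (_p : ℝ × ℝ) : ℝ :=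
  if m.cellOf T = i then (∑ S ∈ m.cellTris i, m.area S)⁻¹ else 0

/-- The basis function `β j` of `V²`: constant on the dual cell `j` with integral 1, 0 elsewhere. -/
def beta (j : V) (T : SubTri E) (_p : ℝ × ℝ) : ℝ :=
  if m.vertOf T = j then (∑ S ∈ m.dualTris j, m.area S)⁻¹ else 0

/-- The basis function `γ j` of `V₀`: the compound piecewise linear function that is 1 at the
vertex `j` and 0 at the other vertices. -/
def gamma (j : V) : SubTri E → ℝ × ℝ → ℝ := p1 (m.hatVals j (m.exists_hat j).choose)

/-- The basis function `v e` of `V₁`: the compound Raviart-Thomas field with flux 1 through `e`. -/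
def v (e : E) : SubTri E → ℝ × ℝ → Fin 3 → ℝ := m.rt0 (m.exists_primal_rt0 e).choose

/-- The basis function `w e` of `V¹`: `k ×` the compound Raviart-Thomas field of the dual mesh. -/
def w (e : E) (T : SubTri E) (p : ℝ × ℝ) : Fin 3 → ℝ :=
  m.perp T (m.rt0 (m.exists_dual_rt0 e).choose T p)

/-! ### Incidence matrices and mass matrices -/

/-- `n_{e i}`: `1` if the normal of `e` points out of the cell `i`, `-1` if it points into it. -/
def nInc (e : E) (i : C) : ℝ :=
  if m.cell e true = i then 1 else if m.cell e false = i then -1 else 0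

/-- `t_{e j}`: `1` if the tangent of `e` points towards the vertex `j`, `-1` if away from it. -/
def tInc (e : E) (j : V) : ℝ :=
  if m.vert e true = j then 1 else if m.vert e false = j then -1 else 0

def D2 : Matrix C E ℝ := .of fun i e => m.nInc e i
def D1 : Matrix E V ℝ := .of fun e j => m.tInc e j
def D1bar : Matrix E C ℝ := -m.D2ᵀ
def D2bar : Matrix V E ℝ := m.D1ᵀ

/-- The inner product `⟨f, g⟩` of scalar fields on the surface. -/
def innerS (f g : SubTri E → ℝ × ℝ → ℝ) : ℝ :=
  m.intOver Finset.univ fun T p => f T p * g T p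

/-- The inner product `⟨f, g⟩` of vector fields on the surface. -/
def innerV (f g : SubTri E → ℝ × ℝ → Fin 3 → ℝ) : ℝ :=
  m.intOver Finset.univ fun T p => f T p ⬝ᵥ g T p

def L : Matrix C C ℝ := .of fun i i' => m.innerS (m.alpha i) (m.alpha i')
def M : Matrix E E ℝ := .of fun e e' => m.innerV (m.v e) (m.v e')
def N : Matrix V V ℝ := .of fun j j' => m.innerS (m.gamma j) (m.gamma j')
def R : Matrix V C ℝ := .of fun j i => m.innerS (m.gamma j) (m.alpha i)
def W : Matrix E E ℝ := .of fun e e' => -m.innerV (m.v e) (fun T p => m.perp T (m.v e' T p))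
def H : Matrix E E ℝ := .of fun e e' => m.innerV (m.v e) (m.w e')
def J : Matrix V V ℝ := .of fun j j' => m.innerS (m.gamma j) (m.beta j')

/-- `T_{i e e'} = ∫_{cell i} v_e · v_{e'} dA`. -/
def kinT (i : C) (e e' : E) : ℝ :=
  m.intOver (m.cellTris i) fun T p => m.v e T p ⬝ᵥ m.v e' T p

/-- Coefficients of the kinetic energy per unit mass. -/
def kinetic (U : E → ℝ) (i : C) : ℝ := (∑ e, ∑ e', m.kinT i e e' * U e * U e') / 2

/-- The field of `V²` with coefficients `X`. -/
def dualField (X : V → ℝ) (T : SubTri E) (p : ℝ × ℝ) : ℝ := ∑ j, X j * m.beta j T p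

end Basis

end PolygonalMesh

/-! ### The nonlinear shallow water scheme -/

/-- The coefficient vectors of the scheme as functions of time. -/
structure SWTrajectory (V E C : Type*) where
  /-- geopotential in `V₂` -/
  Phi : ℝ → C → ℝ
  /-- velocity in `V₁` -/
  U : ℝ → E → ℝ
  /-- mass flux in `V₁` -/
  F : ℝ → E → ℝ
  /-- `F̂^⊥`, dual mass flux in `V¹` -/
  FhatPerp : ℝ → E → ℝ
  /-- `Q^⊥`, PV flux in `V₁` -/
  QPerp : ℝ → E → ℝ
  /-- `Q̂^⊥`, dual PV flux in `V¹` -/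
  QhatPerp : ℝ → E → ℝ
  /-- dual mass field in `V²` -/
  PhiBar : ℝ → V → ℝ
  /-- relative vorticity in `V₀` -/
  Xi : ℝ → V → ℝ
  /-- dual relative vorticity in `V²` -/
  XiHat : ℝ → V → ℝ
  /-- potential vorticity in `V²` -/
  PV : ℝ → V → ℝ

/-- The nonlinear scheme on the set of times `I`, with orography coefficients `PhiOrog` in `V₂`,
Coriolis coefficients `cor` in `V²`, and advection operators `adv1` on the primal mesh and `adv2` on
the dual mesh. -/
structure SWTrajectory.Solves {V E C : Type*} [Fintype V] [Fintype E] [Fintype C]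
    [DecidableEq V] [DecidableEq E] [DecidableEq C] (s : SWTrajectory V E C)
    (m : PolygonalMesh V E C) (adv1 : (E → ℝ) → (C → ℝ) → E → ℝ)
    (adv2 : (E → ℝ) → (V → ℝ) → E → ℝ) (PhiOrog : C → ℝ) (cor : V → ℝ) (I : Set ℝ) : Prop where
  /-- `dΦ/dt + D₂ F = 0` -/
  mass : ∀ t ∈ I, ∃ dPhi, HasDerivWithinAt s.Phi dPhi I t ∧ dPhi + m.D2 *ᵥ s.F t = 0
  /-- `M dU/dt + M Q^⊥ + D̄₁ L (Φ_T + K) = 0` with `Φ_T = Φ + Φ_orog` -/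
  momentum : ∀ t ∈ I, ∃ dU, HasDerivWithinAt s.U dU I t ∧
    m.M *ᵥ dU + m.M *ᵥ s.QPerp t +
      m.D1bar *ᵥ (m.L *ᵥ ((s.Phi t + PhiOrog) + m.kinetic (s.U t))) = 0
  massFlux : ∀ t ∈ I, s.F t = adv1 (s.U t) (s.Phi t)
  dualMassFlux : ∀ t ∈ I, m.H *ᵥ s.FhatPerp t = -(m.W *ᵥ s.F t)
  dualMass : ∀ t ∈ I, m.J *ᵥ s.PhiBar t = m.R *ᵥ s.Phi t
  vorticity : ∀ t ∈ I, m.N *ᵥ s.Xi t = m.D2bar *ᵥ (m.M *ᵥ s.U t)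
  dualVorticity : ∀ t ∈ I, m.J *ᵥ s.XiHat t = m.N *ᵥ s.Xi t
  /-- `π = (f + ξ̂) / φ̄`, in the form `π φ̄ = f + ξ̂`, pointwise on the surface -/
  pv : ∀ t ∈ I, ∀ T p, m.dualField (s.PV t) T p * m.dualField (s.PhiBar t) T p =
    m.dualField cor T p + m.dualField (s.XiHat t) T p
  pvFlux : ∀ t ∈ I, s.QhatPerp t = adv2 (s.FhatPerp t) (s.PV t)
  primalPVFlux : ∀ t ∈ I, m.H *ᵥ s.QhatPerp t = m.M *ᵥ s.QPerp t

end

/-!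
A compound Raviart-Thomas field is determined by its fluxes through the boundary of the compound
elements: if these vanish, then so does the divergence, hence the field circulates around the centre
of each element with a constant flux, which is zero because the field is weakly curl-free. Comparing
boundary fluxes yields `k × ∇γ_j = -∑_e t_{ej} v_e`. For every Raviart-Thomas field `f` with
continuous normal component, Green's formula then gives

  `∑_e t_{ej} ⟨v_e, k × f⟩ = -⟨∇γ_j, f⟩ = ⟨γ_j, div f⟩`.

Since `div r_e = ∑_j t_{ej} β_j` and `div v_e = ∑_i n_{ei} α_i`, the cases `f = r_e` and `f = v_e`
read `D̄₂ H = J D̄₂` and `D̄₂ W = -R D₂`, and `D̄₂ D̄₁ = 0` because the incidence matrices form a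
complex. Applying `R` to the mass equation and `D̄₂` to the momentum equation and cancelling `J`
gives the dual equations. As `β_j` has integral 1, the coefficients of a dual field are its
integrals over the dual cells.
-/

theorem sum_filter_eq_zero_of_antisymm {F κ : Type*} [Fintype F] [DecidableEq κ] {σ : F → F}
    (hσ : Function.Involutive σ) {elem : F → κ} (helem : ∀ T, elem (σ T) = elem T) {u : F → ℝ}
    (hu : ∀ T, u (σ T) = -u T) (i : κ) : ∑ T with elem T = i, u T = 0 := by
  have hsum : ∑ T with elem T = i, u T = ∑ T with elem T = i, u (σ T) :=
    Finset.sum_nbij' σ σ (by simp [helem]) (by simp [helem]) (by simp [hσ _]) (by simp [hσ _])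
      (by simp [hσ _])
  simp only [hu, Finset.sum_neg_distrib] at hsum
  linarith

theorem sum_eq_zero_of_antisymm {F : Type*} [Fintype F] {σ : F → F}
    (hσ : Function.Involutive σ) {u : F → ℝ} (hu : ∀ T, u (σ T) = -u T) : ∑ T, u T = 0 := by
  simpa using sum_filter_eq_zero_of_antisymm hσ (elem := fun _ => ()) (fun _ => rfl) hu ()

theorem hasDerivWithinAt_mulVec {ι κ : Type*} [Fintype ι] [Finite κ] (A : Matrix κ ι ℝ)
    {x : ℝ → ι → ℝ} {x' : ι → ℝ} {I : Set ℝ} {t : ℝ} (hx : HasDerivWithinAt x x' I t) :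
    HasDerivWithinAt (fun r => A *ᵥ x r) (A *ᵥ x') I t := by
  have := Fintype.ofFinite κ
  exact A.mulVecLin.toContinuousLinearMap.hasFDerivAt.comp_hasDerivWithinAt t hx

theorem hasDerivWithinAt_of_mulVec_eq {ι κ : Type*} [Fintype ι] [DecidableEq ι] [Fintype κ]
    {A : Matrix ι ι ℝ} (hA : IsUnit A) (B : Matrix ι κ ℝ) {x : ℝ → ι → ℝ} {y : ℝ → κ → ℝ}
    {x' : ι → ℝ} {y' : κ → ℝ} {I : Set ℝ} {t : ℝ} (ht : t ∈ I)
    (hxy : ∀ r ∈ I, A *ᵥ x r = B *ᵥ y r) (hy : HasDerivWithinAt y y' I t)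
    (hx' : A *ᵥ x' = B *ᵥ y') : HasDerivWithinAt x x' I t := by
  have hsolve (z : ι → ℝ) : A⁻¹ *ᵥ (A *ᵥ z) = z := by
    rw [Matrix.mulVec_mulVec, Matrix.nonsing_inv_mul A ((Matrix.isUnit_iff_isUnit_det A).1 hA),
      Matrix.one_mulVec]
  have hderiv := hasDerivWithinAt_mulVec A⁻¹ (hasDerivWithinAt_mulVec B hy)
  rw [← hx', hsolve] at hderiv
  exact hderiv.congr_of_mem (fun r hr => by rw [← hxy r hr, hsolve]) ht

namespace PolygonalMesh

variable {V E C : Type*} (m : PolygonalMesh V E C)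

/-! ### Integrals over a facet -/

theorem continuous_bary (k : Fin 3) : Continuous fun p => bary p k := by
  unfold bary
  fin_cases k
  exacts [(continuous_const.sub continuous_fst).sub continuous_snd, continuous_fst, continuous_snd]

theorem sum_bary (p : ℝ × ℝ) : ∑ k, bary p k = 1 := by
  simp only [Fin.sum_univ_three, bary, Matrix.cons_val]
  ring

theorem integrableOn_refTri {F : Type*} [NormedAddCommGroup F] {f : ℝ × ℝ → F}
    (hf : Continuous f) : IntegrableOn f refTri :=
  hf.continuousOn.integrableOn_compact isCompact_refTri

theorem setIntegral_refTri {F : Type*} [NormedAddCommGroup F] [NormedSpace ℝ F] {f : ℝ × ℝ → F}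
    (hf : IntegrableOn f refTri) :
    ∫ p in refTri, f p = ∫ x in (0 : ℝ)..1, ∫ y in (0 : ℝ)..(1 - x), f (x, y) := by
  have hmeas : MeasurableSet refTri := isCompact_refTri.measurableSet
  have hslice (x : ℝ) : ∫ y, refTri.indicator f (x, y) =
      (Set.Icc 0 1).indicator (fun x => ∫ y in (0 : ℝ)..(1 - x), f (x, y)) x := by
    by_cases hx : x ∈ Set.Icc (0 : ℝ) 1
    · rw [Set.indicator_of_mem hx, intervalIntegral.integral_of_le (sub_nonneg.2 hx.2),
        ← integral_Icc_eq_integral_Ioc, ← integral_indicator measurableSet_Icc]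
      congr with y
      have hmem : (x, y) ∈ refTri ↔ y ∈ Set.Icc 0 (1 - x) := by
        simp [refTri, hx.1, le_sub_iff_add_le']
      simp only [Set.indicator, hmem]
    · have hempty (y : ℝ) : (x, y) ∉ refTri := fun ⟨hx0, hy0, hxy⟩ =>
        hx ⟨hx0, (le_add_of_nonneg_right hy0).trans hxy⟩
      simp [hx, hempty]
  rw [← integral_indicator hmeas, Measure.volume_eq_prod, integral_prod _
    (by rwa [← Measure.volume_eq_prod, integrable_indicator_iff hmeas])]
  simp only [hslice]
  rw [integral_indicator measurableSet_Icc, integral_Icc_eq_integral_Ioc,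
    intervalIntegral.integral_of_le zero_le_one]

theorem setIntegral_refTri_affine (a b c : ℝ) :
    ∫ p in refTri, (a + b * p.1 + c * p.2) = a / 2 + b / 6 + c / 6 := by
  have hinner (x : ℝ) : ∫ y in (0 : ℝ)..(1 - x), (a + b * x + c * y) =
      (a + c / 2) + (b - a - c) * x + (c / 2 - b) * x ^ 2 := by
    rw [intervalIntegral.integral_add (Continuous.intervalIntegrable (by fun_prop) _ _)
        (Continuous.intervalIntegrable (by fun_prop) _ _), intervalIntegral.integral_const,
      intervalIntegral.integral_const_mul, integral_id, smul_eq_mul]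
    ring
  rw [setIntegral_refTri (integrableOn_refTri (by fun_prop))]
  simp only [hinner]
  rw [intervalIntegral.integral_add (Continuous.intervalIntegrable (by fun_prop) _ _)
      (Continuous.intervalIntegrable (by fun_prop) _ _),
    intervalIntegral.integral_add (Continuous.intervalIntegrable (by fun_prop) _ _)
      (Continuous.intervalIntegrable (by fun_prop) _ _),
    intervalIntegral.integral_const_mul, intervalIntegral.integral_const_mul,
    intervalIntegral.integral_const, integral_id, integral_pow, smul_eq_mul]
  norm_num
  ring

theorem continuous_p1 (g : SubTri E → Fin 3 → ℝ) (T : SubTri E) : Continuous (p1 g T) :=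
  continuous_finsetSum _ fun k _ => (continuous_bary k).mul continuous_const

theorem facetInt_p1 (g : SubTri E → Fin 3 → ℝ) (T : SubTri E) :
    m.facetInt T (p1 g T) = m.area T * (∑ k, g T k) / 3 := by
  have haff (p : ℝ × ℝ) : p1 g T p = g T 0 + (g T 1 - g T 0) * p.1 + (g T 2 - g T 0) * p.2 := by
    simp only [p1, bary, Fin.sum_univ_three, Matrix.cons_val]
    ring
  simp only [facetInt, haff, setIntegral_refTri_affine, Fin.sum_univ_three]
  ring

theorem facetInt_const (T : SubTri E) (a : ℝ) : m.facetInt T (fun _ => a) = m.area T * a := by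
  have h := setIntegral_refTri_affine a 0 0
  simp only [zero_mul, add_zero, zero_div] at h
  rw [facetInt, h]
  ring

theorem facetInt_mul_const (T : SubTri E) (f : ℝ × ℝ → ℝ) (a : ℝ) :
    m.facetInt T (fun p => f p * a) = m.facetInt T f * a := by
  rw [facetInt, integral_mul_const, facetInt]
  ring

theorem intOver_sum_mul {ι : Type*} (S : Finset (SubTri E)) (s : Finset ι) (a : ι → ℝ)
    {f : ι → SubTri E → ℝ × ℝ → ℝ} (hf : ∀ x ∈ s, ∀ T ∈ S, IntegrableOn (f x T) refTri) :
    m.intOver S (fun T p => ∑ x ∈ s, a x * f x T p) = ∑ x ∈ s, a x * m.intOver S (f x) := by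
  simp only [intOver, facetInt, Finset.mul_sum]
  rw [Finset.sum_comm]
  refine Finset.sum_congr rfl fun T hT => ?_
  rw [integral_finsetSum _ fun x hx => (hf x hx T hT).const_mul (a x), Finset.mul_sum]
  refine Finset.sum_congr rfl fun x _ => ?_
  rw [integral_const_mul, mul_left_comm]

theorem innerS_sum_mul [Fintype E] {ι : Type*} (s : Finset ι) (a : ι → ℝ)
    {g : SubTri E → ℝ × ℝ → ℝ} {f : ι → SubTri E → ℝ × ℝ → ℝ} (hg : ∀ T, Continuous (g T))
    (hf : ∀ x ∈ s, ∀ T, Continuous (f x T)) :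
    m.innerS g (fun T p => ∑ x ∈ s, a x * f x T p) = ∑ x ∈ s, a x * m.innerS g (f x) := by
  simp only [innerS, Finset.mul_sum, mul_left_comm]
  exact m.intOver_sum_mul _ _ _ fun x hx T _ => integrableOn_refTri ((hg T).mul (hf x hx T))

/-! ### Gradients and Raviart-Thomas fields on a facet -/

theorem sum_eq_cyclic {M : Type*} [AddCommMonoid M] (u : Fin 3 → M) (o : Fin 3) :
    ∑ k, u k = u o + u (o + 1) + u (o + 2) := by
  rw [← Equiv.sum_comp (Equiv.addLeft o), Fin.sum_univ_three]
  simp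

theorem two_mul_area (T : SubTri E) : 2 * m.area T = len3 (m.nvec T) := by
  rw [area, mul_div_cancel₀ _ two_ne_zero]

theorem sum_side (T : SubTri E) : ∑ k, m.side T k = 0 := by
  simp only [side, Fin.sum_univ_three, Fin.reduceAdd, zero_add]
  abel

theorem side_cross_side_add_one (T : SubTri E) (k : Fin 3) :
    m.side T k ⨯₃ m.side T (k + 1) = m.nvec T := by
  fin_cases k <;> ext i <;> fin_cases i <;> simp [side, nvec, cross_apply] <;> ring

theorem gradBary_dot_side_self (T : SubTri E) (k : Fin 3) :
    m.gradBary T k ⬝ᵥ m.side T k = 0 := by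
  change ((len3 (m.nvec T) ^ 2)⁻¹ • (m.nvec T ⨯₃ m.side T k)) ⬝ᵥ m.side T k = 0
  rw [smul_dotProduct, dotProduct_comm, dot_cross_self, smul_zero]

theorem gradBary_dot_side_add_one (T : SubTri E) (k : Fin 3) :
    m.gradBary T k ⬝ᵥ m.side T (k + 1) = 1 := by
  have hlen := (pow_pos (len3_pos (m.nvec_ne T)) 2).ne'
  change ((len3 (m.nvec T) ^ 2)⁻¹ • (m.nvec T ⨯₃ m.side T k)) ⬝ᵥ m.side T (k + 1) = 1
  rw [smul_dotProduct, dotProduct_comm, triple_product_permutation, side_cross_side_add_one,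
    ← len3_sq, smul_eq_mul, inv_mul_cancel₀ hlen]

theorem gradBary_dot_side_add_two (T : SubTri E) (k : Fin 3) :
    m.gradBary T k ⬝ᵥ m.side T (k + 2) = -1 := by
  have hsum := congrArg (m.gradBary T k ⬝ᵥ ·) (m.sum_side T)
  simp only [sum_eq_cyclic _ k, dotProduct_add, gradBary_dot_side_self, gradBary_dot_side_add_one,
    dotProduct_zero] at hsum
  linarith

theorem gradP1_dot_side (g : SubTri E → Fin 3 → ℝ) (T : SubTri E) (k : Fin 3) :
    m.gradP1 g T ⬝ᵥ m.side T k = g T (k + 2) - g T (k + 1) := by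
  have hself := m.gradBary_dot_side_self T k
  have hadd_one := m.gradBary_dot_side_add_one T (k + 2)
  have hadd_two := m.gradBary_dot_side_add_two T (k + 1)
  simp only [add_assoc, Fin.reduceAdd, add_zero] at hadd_one hadd_two
  rw [gradP1, sum_eq_cyclic _ k]
  simp only [add_dotProduct, smul_dotProduct, smul_eq_mul, hself, hadd_one, hadd_two]
  ring

theorem kvec_dot_kvec (T : SubTri E) : m.kvec T ⬝ᵥ m.kvec T = 1 := by
  have hlen := (len3_pos (m.nvec_ne T)).ne'
  rw [kvec, smul_dotProduct, dotProduct_smul, ← len3_sq, smul_eq_mul, smul_eq_mul]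
  field_simp
  rw [sq, orient_mul_self]

theorem kvec_dot_gradBary (T : SubTri E) (k : Fin 3) : m.kvec T ⬝ᵥ m.gradBary T k = 0 := by
  rw [kvec, gradBary, smul_dotProduct, dotProduct_smul, dot_self_cross, smul_zero, smul_zero]

theorem kvec_dot_gradP1 (g : SubTri E → Fin 3 → ℝ) (T : SubTri E) :
    m.kvec T ⬝ᵥ m.gradP1 g T = 0 := by
  simp only [gradP1, dotProduct_sum, dotProduct_smul, kvec_dot_gradBary, smul_zero,
    Finset.sum_const_zero]

theorem perp_dot_perp {T : SubTri E} {u : Fin 3 → ℝ} (hu : m.kvec T ⬝ᵥ u = 0) (v : Fin 3 → ℝ) :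
    m.perp T u ⬝ᵥ m.perp T v = u ⬝ᵥ v := by
  rw [perp, perp, cross_dot_cross, kvec_dot_kvec, dotProduct_comm u (m.kvec T), hu]
  ring

theorem sum_bary_smul_sub (p : ℝ × ℝ) (x : Fin 3 → Fin 3 → ℝ) (y : Fin 3 → ℝ) :
    ∑ k, bary p k • x k - y = ∑ k, bary p k • (x k - y) := by
  simp only [smul_sub, Finset.sum_sub_distrib, ← Finset.sum_smul, sum_bary, one_smul]

theorem sum_corner_sub_corner (T : SubTri E) (k : Fin 3) :
    ∑ l, (m.corner T l - m.corner T k) = m.side T (k + 2) - m.side T (k + 1) := by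
  rw [sum_eq_cyclic _ k]
  simp only [side, add_assoc, Fin.reduceAdd, add_zero]
  abel

theorem facetInt_dot_rt0 (a : Fin 3 → ℝ) (f : SubTri E → Fin 3 → ℝ) (T : SubTri E) :
    m.facetInt T (fun p => a ⬝ᵥ m.rt0 f T p) =
      (∑ k, (f T (k + 1) - f T (k + 2)) * (a ⬝ᵥ m.side T k)) / 6 := by
  have harea := (m.area_pos T).ne'
  have hp1 : (fun p => a ⬝ᵥ m.rt0 f T p) = p1 (fun T l => ∑ k, f T k / (2 * m.area T) *
      (a ⬝ᵥ (m.corner T l - m.corner T k))) T := by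
    ext p
    simp only [p1, rt0, pt, sum_bary_smul_sub, dotProduct_sum, dotProduct_smul, smul_eq_mul,
      Finset.mul_sum]
    rw [Finset.sum_comm]
    exact Finset.sum_congr rfl fun _ _ => Finset.sum_congr rfl fun _ _ => mul_left_comm _ _ _
  rw [hp1, facetInt_p1, Finset.sum_comm]
  simp only [← Finset.mul_sum, ← dotProduct_sum, sum_corner_sub_corner]
  simp only [dotProduct_sub, Fin.sum_univ_three, Fin.reduceAdd, zero_add]
  field_simp
  ring

theorem facetInt_gradP1_dot_rt0 (g f : SubTri E → Fin 3 → ℝ) (T : SubTri E) :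
    m.facetInt T (fun p => m.gradP1 g T ⬝ᵥ m.rt0 f T p) =
      (∑ k, f T k * ((g T (k + 1) + g T (k + 2)) / 2)) -
        m.facetInt T (fun p => p1 g T p * m.divRT0 f T) := by
  have harea := (m.area_pos T).ne'
  rw [facetInt_dot_rt0, facetInt_mul_const, facetInt_p1, divRT0]
  simp only [gradP1_dot_side, Fin.sum_univ_three, Fin.reduceAdd, zero_add]
  field_simp
  ring

/-- The fluxes out of the facets of the rotated gradient `k × ∇ (p1 g)`: the flux through a side is
the difference of the values of `g` at its ends. -/
def rotGradFlux (g : SubTri E → Fin 3 → ℝ) (T : SubTri E) (k : Fin 3) : ℝ :=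
  orient T * (g T (k + 1) - g T (k + 2))

theorem sum_rotGradFlux (g : SubTri E → Fin 3 → ℝ) (T : SubTri E) :
    ∑ k, rotGradFlux g T k = 0 := by
  simp only [rotGradFlux, Fin.sum_univ_three, Fin.reduceAdd, zero_add]
  ring

theorem divRT0_rotGradFlux (g : SubTri E → Fin 3 → ℝ) (T : SubTri E) :
    m.divRT0 (rotGradFlux g) T = 0 := by
  rw [divRT0, sum_rotGradFlux, zero_div]

theorem rt0_rotGradFlux (g : SubTri E → Fin 3 → ℝ) (T : SubTri E) (p : ℝ × ℝ) :
    m.rt0 (rotGradFlux g) T p = m.perp T (m.gradP1 g T) := by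
  have hpoint : m.rt0 (rotGradFlux g) T p =
      -∑ k, (rotGradFlux g T k / (2 * m.area T)) • m.corner T k := by
    simp only [rt0, smul_sub, Finset.sum_sub_distrib, ← Finset.sum_smul, ← Finset.sum_div,
      sum_rotGradFlux, zero_div, zero_smul, zero_sub]
  have hperp : m.perp T (m.gradP1 g T) = ∑ k, g T k • m.perp T (m.gradBary T k) := by
    simp only [perp, gradP1, map_sum, map_smul]
  rw [hpoint, hperp]
  ext i
  simp only [perp_gradBary, rotGradFlux, side, two_mul_area, Fin.sum_univ_three, Fin.reduceAdd,
    zero_add, Pi.neg_apply, Pi.add_apply, Pi.sub_apply, Pi.smul_apply, smul_eq_mul]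
  ring

theorem rt0_sum_smul {ι : Type*} (s : Finset ι) (a : ι → ℝ) (f : ι → SubTri E → Fin 3 → ℝ)
    (T : SubTri E) (p : ℝ × ℝ) :
    m.rt0 (∑ x ∈ s, a x • f x) T p = ∑ x ∈ s, a x • m.rt0 (f x) T p := by
  simp only [rt0, Finset.sum_apply, Pi.smul_apply, smul_eq_mul, Finset.sum_div, Finset.sum_smul,
    Finset.smul_sum, smul_smul, mul_div_assoc]
  exact Finset.sum_comm

theorem rt0_neg (f : SubTri E → Fin 3 → ℝ) (T : SubTri E) (p : ℝ × ℝ) :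
    m.rt0 (-f) T p = -m.rt0 f T p := by
  simp only [rt0, Pi.neg_apply, neg_div, neg_smul, Finset.sum_neg_distrib]

theorem continuous_rt0 (f : SubTri E → Fin 3 → ℝ) (T : SubTri E) : Continuous (m.rt0 f T) := by
  have hpt : Continuous (m.pt T) :=
    continuous_finsetSum _ fun k _ => (continuous_bary k).smul continuous_const
  exact continuous_finsetSum _ fun k _ => (hpt.fun_sub continuous_const).fun_const_smul _

theorem continuous_perp (T : SubTri E) : Continuous (m.perp T) :=
  LinearMap.continuous_of_finiteDimensional (crossProduct (m.kvec T))

/-! ### Cancellation across the sides of the facets -/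

/-- The fluxes `f` define a Raviart-Thomas field with continuous normal component: what flows out
of a facet through a side flows into the neighbour. -/
def IsNormalContinuous (f : SubTri E → Fin 3 → ℝ) : Prop :=
  ∀ k T, f (m.adj k T) k = -f T k

/-- The corner values `g` define a continuous piecewise linear function: neighbouring facets have
the same values at the ends of their common side. -/
def IsContinuousP1 (g : SubTri E → Fin 3 → ℝ) : Prop :=
  ∀ k l T, l ≠ k → g (m.adj k T) l = g T l

theorem add_one_ne (k : Fin 3) : k + 1 ≠ k := by fin_cases k <;> decide

theorem add_two_ne (k : Fin 3) : k + 2 ≠ k := by fin_cases k <;> decide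

variable {m} in
theorem IsContinuousP1.isNormalContinuous_rotGradFlux {g : SubTri E → Fin 3 → ℝ}
    (hg : m.IsContinuousP1 g) : m.IsNormalContinuous (rotGradFlux g) := fun k T => by
  rw [rotGradFlux, rotGradFlux, hg _ _ _ (add_one_ne k), hg _ _ _ (add_two_ne k), orient_adj]
  ring

theorem innerV_gradP1_rt0 [Fintype E] {g f : SubTri E → Fin 3 → ℝ} (hg : m.IsContinuousP1 g)
    (hf : m.IsNormalContinuous f) :
    m.innerV (fun T _ => m.gradP1 g T) (m.rt0 f) =
      -m.innerS (p1 g) (fun T _ => m.divRT0 f T) := by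
  have hboundary : ∑ T, ∑ k, f T k * ((g T (k + 1) + g T (k + 2)) / 2) = 0 := by
    rw [Finset.sum_comm]
    refine Finset.sum_eq_zero fun k _ => sum_eq_zero_of_antisymm (m.adj_adj k) fun T => ?_
    rw [hf, hg _ _ _ (add_one_ne k), hg _ _ _ (add_two_ne k), neg_mul]
  rw [innerV, innerS, intOver, intOver]
  simp only [facetInt_gradP1_dot_rt0]
  rw [Finset.sum_sub_distrib, hboundary, zero_sub]

/-! ### Compound elements -/

/-- The facets are grouped by `elem` into compound elements, each of which is a connected fan of
facets whose common corner, the centre, is corner `o`. -/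
structure IsFanPartition {κ : Type*} (o : Fin 3) (elem : SubTri E → κ) : Prop where
  elem_adj : ∀ k ≠ o, ∀ T, elem (m.adj k T) = elem T
  connected : ∀ T T', elem T = elem T' →
    Relation.EqvGen (fun S S' => ∃ k ≠ o, S' = m.adj k S) T T'

theorem isFanPartition_cellOf : m.IsFanPartition 2 m.cellOf where
  elem_adj k hk T := by
    fin_cases k
    exacts [rfl, m.cOf_turn T, absurd rfl hk]
  connected T T' hT := (m.cell_cycle T T' hT).mono fun S S' h =>
    h.elim (fun h => ⟨0, by decide, h⟩) fun h => ⟨1, by decide, h⟩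

theorem isFanPartition_vertOf : m.IsFanPartition 0 m.vertOf where
  elem_adj k hk T := by
    fin_cases k
    exacts [absurd rfl hk, m.vOf_turn T, rfl]
  connected T T' hT := (m.vert_cycle T T' hT).mono fun S S' h =>
    h.elim (fun h => ⟨1, by decide, h⟩) fun h => ⟨2, by decide, h⟩

section Compound

variable {m} {κ : Type*} {o : Fin 3} {elem : SubTri E → κ} {b : SubTri E → ℝ}
  {f : SubTri E → Fin 3 → ℝ}

theorem IsFanPartition.eq_of_adj_invariant (h : m.IsFanPartition o elem) {X : Type*}
    {c : SubTri E → X} (hc : ∀ k ≠ o, ∀ T, c (m.adj k T) = c T) {T T' : SubTri E}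
    (hT : elem T = elem T') : c T = c T' := by
  have heqv : Equivalence fun S S' => c S = c S' := ⟨fun _ => rfl, Eq.symm, Eq.trans⟩
  refine heqv.eqvGen_iff.1 ((h.connected T T' hT).mono ?_)
  rintro S _ ⟨k, hk, rfl⟩
  exact (hc k hk S).symm

variable [Fintype E] [DecidableEq κ]

theorem sum_area_pos (T : SubTri E) : 0 < ∑ S with elem S = elem T, m.area S :=
  Finset.sum_pos (fun S _ => m.area_pos S) ⟨T, by simp⟩

theorem IsFanPartition.sum_divRT0_mul_area (h : m.IsFanPartition o elem)
    (hf : m.IsNormalContinuous f) (i : κ) :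
    ∑ T with elem T = i, m.divRT0 f T * m.area T = ∑ T with elem T = i, f T o := by
  have hinner (k : Fin 3) (hk : k ≠ o) : ∑ T with elem T = i, f T k = 0 :=
    sum_filter_eq_zero_of_antisymm (m.adj_adj k) (h.elem_adj k hk) (hf k) i
  simp only [divRT0, div_mul_cancel₀ _ (m.area_pos _).ne', sum_eq_cyclic _ o]
  rw [Finset.sum_add_distrib, Finset.sum_add_distrib, hinner _ (add_one_ne o),
    hinner _ (add_two_ne o), add_zero, add_zero]

namespace IsCompoundRT0

theorem divRT0_eq (hf : m.IsCompoundRT0 o elem b f) (h : m.IsFanPartition o elem)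
    (T : SubTri E) :
    m.divRT0 f T = (∑ S with elem S = elem T, b S) / ∑ S with elem S = elem T, m.area S := by
  have hconst : ∀ S ∈ ({S | elem S = elem T} : Finset (SubTri E)),
      m.divRT0 f S * m.area S = m.divRT0 f T * m.area S := fun S hS => by
    rw [hf.div_const S T (Finset.mem_filter.1 hS).2]
  rw [eq_div_iff (sum_area_pos T).ne', Finset.mul_sum, ← Finset.sum_congr rfl hconst,
    h.sum_divRT0_mul_area hf.normal_cont]
  simp only [hf.boundary]

theorem add_two_eq_neg_add_one (hf : m.IsCompoundRT0 o elem 0 f) (h : m.IsFanPartition o elem)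
    (T : SubTri E) : f T (o + 2) = -f T (o + 1) := by
  have hdiv := hf.divRT0_eq h T
  simp only [Pi.zero_apply, Finset.sum_const_zero, zero_div] at hdiv
  rw [divRT0, div_eq_zero_iff, or_iff_left (m.area_pos T).ne', sum_eq_cyclic _ o, hf.boundary,
    Pi.zero_apply, zero_add] at hdiv
  exact eq_neg_of_add_eq_zero_right hdiv

theorem orient_mul_eq (hf : m.IsCompoundRT0 o elem 0 f) (h : m.IsFanPartition o elem)
    {T T' : SubTri E} (hT : elem T = elem T') :
    orient T * f T (o + 1) = orient T' * f T' (o + 1) := by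
  refine h.eq_of_adj_invariant (c := fun T => orient T * f T (o + 1)) (fun k hk T => ?_) hT
  have hnormal := hf.normal_cont k T
  obtain rfl | rfl : k = o + 1 ∨ k = o + 2 := by
    fin_cases o <;> fin_cases k <;> first | exact absurd rfl hk | decide
  · rw [orient_adj, hnormal, neg_mul_neg]
  · rw [hf.add_two_eq_neg_add_one h, hf.add_two_eq_neg_add_one h, neg_neg] at hnormal
    rw [orient_adj, ← hnormal, neg_mul, mul_neg]

theorem facetInt_perp_gradBary_dot_rt0 (hf : m.IsCompoundRT0 o elem 0 f)
    (h : m.IsFanPartition o elem) (T : SubTri E) :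
    m.facetInt T (fun p => m.perp T (m.gradBary T o) ⬝ᵥ m.rt0 f T p) =
      -(orient T * f T (o + 1)) * (m.side T o ⬝ᵥ m.side T o / (2 * len3 (m.nvec T))) := by
  have hside := congrArg (m.side T o ⬝ᵥ ·) (m.sum_side T)
  simp only [sum_eq_cyclic _ o, dotProduct_add, dotProduct_zero] at hside
  rw [facetInt_dot_rt0, sum_eq_cyclic _ o]
  simp only [perp_gradBary, smul_dotProduct, smul_eq_mul, add_assoc, Fin.reduceAdd, add_zero,
    hf.add_two_eq_neg_add_one h, hf.boundary, Pi.zero_apply]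
  linear_combination (orient T / len3 (m.nvec T) * f T (o + 1) / 6) * hside

theorem eq_zero (hf : m.IsCompoundRT0 o elem 0 f) (h : m.IsFanPartition o elem) : f = 0 := by
  have hcirc (T : SubTri E) : orient T * f T (o + 1) = 0 := by
    have hcurl := hf.weak_curl (elem T)
    have hconst : ∀ S ∈ ({S | elem S = elem T} : Finset (SubTri E)),
        m.facetInt S (fun p => m.perp S (m.gradBary S o) ⬝ᵥ m.rt0 f S p) =
          -(orient T * f T (o + 1)) * (m.side S o ⬝ᵥ m.side S o / (2 * len3 (m.nvec S))) :=
      fun S hS => by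
        rw [hf.facetInt_perp_gradBary_dot_rt0 h, hf.orient_mul_eq h (Finset.mem_filter.1 hS).2]
    rw [intOver, Finset.sum_congr rfl hconst, ← Finset.mul_sum] at hcurl
    have hpos : 0 < ∑ S with elem S = elem T,
        m.side S o ⬝ᵥ m.side S o / (2 * len3 (m.nvec S)) :=
      Finset.sum_pos (fun S _ => div_pos (m.side_dot_pos S o)
        (mul_pos two_pos (len3_pos (m.nvec_ne S)))) ⟨T, by simp⟩
    exact neg_eq_zero.1 ((mul_eq_zero.1 hcurl).resolve_right hpos.ne')
  have hadd_one (T : SubTri E) : f T (o + 1) = 0 := by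
    rw [← one_mul (f T _), ← orient_mul_self T, mul_assoc, hcirc, mul_zero]
  funext T k
  obtain rfl | rfl | rfl : k = o ∨ k = o + 1 ∨ k = o + 2 := by
    fin_cases o <;> fin_cases k <;> decide
  · exact hf.boundary T
  · exact hadd_one T
  · rw [hf.add_two_eq_neg_add_one h, hadd_one, neg_zero, Pi.zero_apply, Pi.zero_apply]

end IsCompoundRT0

end Compound

/-- The compound Raviart-Thomas fields, each given by its boundary fluxes and its fluxes out of the
facets. -/
def compoundRT0 [Fintype E] {κ : Type*} [DecidableEq κ] (o : Fin 3) (elem : SubTri E → κ) :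
    Submodule ℝ ((SubTri E → ℝ) × (SubTri E → Fin 3 → ℝ)) where
  carrier := {x | m.IsCompoundRT0 o elem x.1 x.2}
  zero_mem' := by constructor <;> simp [divRT0, intOver, facetInt_dot_rt0]
  add_mem' {x y} hx hy :=
    { normal_cont k T := by simp [hx.normal_cont k T, hy.normal_cont k T, add_comm]
      boundary T := congrArg₂ (· + ·) (hx.boundary T) (hy.boundary T)
      div_const T T' hT := by
        have hdiv := congrArg₂ (· + ·) (hx.div_const T T' hT) (hy.div_const T T' hT)
        simpa only [divRT0, ← add_div, ← Finset.sum_add_distrib, Prod.snd_add, Pi.add_apply]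
          using hdiv
      weak_curl i := by
        have hcurl := congrArg₂ (· + ·) (hx.weak_curl i) (hy.weak_curl i)
        simp only [intOver, facetInt_dot_rt0, ← add_div, ← Finset.sum_add_distrib, ← add_mul,
          add_zero, sub_add_sub_comm] at hcurl
        simpa only [intOver, facetInt_dot_rt0, Prod.snd_add, Pi.add_apply] using hcurl }
  smul_mem' a x hx :=
    { normal_cont k T := by simp [hx.normal_cont k T]
      boundary T := congrArg (a * ·) (hx.boundary T)
      div_const T T' hT := by
        have hdiv := congrArg (a * ·) (hx.div_const T T' hT)
        simpa only [divRT0, ← mul_div_assoc, Finset.mul_sum, Prod.smul_snd, Pi.smul_apply,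
          smul_eq_mul] using hdiv
      weak_curl i := by
        have hcurl := congrArg (a * ·) (hx.weak_curl i)
        simp only [intOver, facetInt_dot_rt0, Finset.mul_sum, ← mul_div_assoc, ← mul_assoc,
          mul_sub, mul_zero] at hcurl
        simpa only [intOver, facetInt_dot_rt0, Prod.smul_snd, Pi.smul_apply, smul_eq_mul]
          using hcurl }

theorem isCompoundRT0_rotGradFlux [Fintype E] [DecidableEq C] {g : SubTri E → Fin 3 → ℝ}
    (hcont : m.IsContinuousP1 g) (hharm : m.IsDiscreteHarmonic g) :
    m.IsCompoundRT0 2 m.cellOf (fun T => orient T * (g T 0 - g T 1)) (rotGradFlux g) where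
  normal_cont := hcont.isNormalContinuous_rotGradFlux
  boundary _ := rfl
  div_const T T' _ := by rw [divRT0_rotGradFlux, divRT0_rotGradFlux]
  weak_curl i := by
    simp only [rt0_rotGradFlux]
    rw [← hharm i]
    refine Finset.sum_congr rfl fun T _ => ?_
    simp only [m.perp_dot_perp (m.kvec_dot_gradBary T 2)]

/-! ### Basis functions and incidence -/

theorem nInc_eq_sum [DecidableEq C] (e : E) (i : C) :
    m.nInc e i = ∑ l : Bool, if m.cell e l = i then bsign l else 0 := by
  have hne := m.cell_ne e
  by_cases htrue : m.cell e true = i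
  · have hfalse : m.cell e false ≠ i := fun h => hne (htrue.trans h.symm)
    simp [nInc, htrue, hfalse, bsign]
  · simp [nInc, htrue, bsign]

theorem tInc_eq_sum [DecidableEq V] (e : E) (j : V) :
    m.tInc e j = ∑ h : Bool, if m.vert e h = j then bsign h else 0 := by
  have hne := m.vert_ne e
  by_cases htrue : m.vert e true = j
  · have hfalse : m.vert e false ≠ j := fun h => hne (htrue.trans h.symm)
    simp [tInc, htrue, hfalse, bsign]
  · simp [tInc, htrue, bsign]

theorem orient_eq_neg_bsign_mul_bsign (e : E) (h l : Bool) :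
    orient (e, h, l) = -(bsign h * bsign l) := by
  cases h <;> cases l <;> simp [orient, bsign]

theorem nInc_mul_tInc [DecidableEq V] [DecidableEq C] (e : E) (i : C) (j : V) :
    m.nInc e i * m.tInc e j = -∑ h : Bool, ∑ l : Bool,
      if m.cellOf (e, h, l) = i ∧ m.vertOf (e, h, l) = j then orient (e, h, l) else 0 := by
  simp only [nInc_eq_sum, tInc_eq_sum, Finset.sum_mul_sum, ← Finset.sum_neg_distrib]
  rw [Finset.sum_comm]
  refine Finset.sum_congr rfl fun h _ => Finset.sum_congr rfl fun l _ => ?_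
  by_cases hi : m.cell e l = i <;> by_cases hj : m.vert e h = j <;>
    simp [cellOf, vertOf, hi, hj, orient_eq_neg_bsign_mul_bsign, mul_comm]

theorem D2_mul_D1 [Fintype E] [DecidableEq V] [DecidableEq C] : m.D2 * m.D1 = 0 := by
  ext i j
  have hcancel : ∑ T : SubTri E,
      (if m.cellOf T = i ∧ m.vertOf T = j then orient T else 0) = 0 := by
    refine sum_eq_zero_of_antisymm m.turn_turn fun T => ?_
    rw [cOf_turn, vOf_turn, show orient (m.turn T) = -orient T from m.orient_adj 1 T]
    split_ifs <;> simp
  simp only [Matrix.mul_apply, D2, D1, Matrix.of_apply, nInc_mul_tInc, Finset.sum_neg_distrib,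
    Matrix.zero_apply]
  simpa only [Fintype.sum_prod_type, neg_eq_zero] using hcancel

theorem halfP_pos (e : E) (h : Bool) : 0 < m.halfP e h :=
  len3_pos fun hzero => m.side_ne (e, h, true) 2 <| by
    simpa [side, corner, vertOf, sub_eq_zero, eq_comm] using hzero

theorem halfD_pos (e : E) (l : Bool) : 0 < m.halfD e l :=
  len3_pos fun hzero => m.side_ne (e, true, l) 0 <| by
    simpa [side, corner, cellOf] using hzero

theorem sum_vFlux [Fintype E] [DecidableEq E] [DecidableEq C] (e : E) (i : C) :
    ∑ T with m.cellOf T = i, m.vFlux e T = m.nInc e i := by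
  have hlen := (add_pos (m.halfP_pos e true) (m.halfP_pos e false)).ne'
  rw [Finset.sum_filter, Fintype.sum_prod_type,
    Finset.sum_eq_single e (fun e' _ he => by simp [vFlux, he]) (by simp), nInc_eq_sum]
  simp only [Fintype.sum_prod_type, vFlux, cellOf, if_true, Fintype.sum_bool]
  split_ifs <;> field_simp <;> ring

theorem sum_wFlux [Fintype E] [DecidableEq E] [DecidableEq V] (e : E) (j : V) :
    ∑ T with m.vertOf T = j, m.wFlux e T = m.tInc e j := by
  have hlen := (add_pos (m.halfD_pos e true) (m.halfD_pos e false)).ne'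
  rw [Finset.sum_filter, Fintype.sum_prod_type,
    Finset.sum_eq_single e (fun e' _ he => by simp [wFlux, he]) (by simp), tInc_eq_sum]
  simp only [Fintype.sum_prod_type, wFlux, vertOf, if_true, Fintype.sum_bool]
  split_ifs <;> field_simp <;> ring

theorem isContinuousP1_hatVals [DecidableEq V] (j : V) (c : C → ℝ) :
    m.IsContinuousP1 (m.hatVals j c) := by
  intro k l T hl
  fin_cases k <;> fin_cases l <;>
    first | exact absurd rfl hl | rfl | simp [hatVals, adj, vOf_turn, cOf_turn]

theorem hatVals_zero_sub_hatVals_one [DecidableEq V] (j : V) (c : C → ℝ) (e : E) (h l : Bool) :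
    m.hatVals j c (e, h, l) 0 - m.hatVals j c (e, h, l) 1 =
      bsign h * (m.halfP e h / (m.halfP e true + m.halfP e false)) * m.tInc e j := by
  have hlen := (add_pos (m.halfP_pos e true) (m.halfP_pos e false)).ne'
  have hne := m.vert_ne e
  simp only [hatVals, vertOf, tInc_eq_sum, Fintype.sum_bool, Matrix.cons_val_zero,
    Matrix.cons_val_one]
  by_cases htrue : m.vert e true = j
  · have hfalse : m.vert e false ≠ j := fun h => hne (htrue.trans h.symm)
    cases h <;> simp [htrue, hfalse, bsign]
    field_simp
    ring
  · by_cases hfalse : m.vert e false = j <;> cases h <;> simp [htrue, hfalse, bsign]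
    field_simp
    ring

theorem sum_tInc_mul_vFlux [Fintype E] [DecidableEq V] [DecidableEq E] (j : V) (c : C → ℝ)
    (T : SubTri E) :
    ∑ e, m.tInc e j * m.vFlux e T = -(orient T * (m.hatVals j c T 0 - m.hatVals j c T 1)) := by
  obtain ⟨e, h, l⟩ := T
  have hsign : bsign h * bsign h = 1 := by cases h <;> simp [bsign]
  rw [Finset.sum_eq_single e (fun e' _ he => by simp [vFlux, he.symm]) (by simp),
    hatVals_zero_sub_hatVals_one, orient_eq_neg_bsign_mul_bsign, vFlux, if_pos rfl]
  linear_combination (-(m.tInc e j * (bsign l *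
    (m.halfP e h / (m.halfP e true + m.halfP e false))))) * hsign

section Flux

variable [Fintype E] [DecidableEq E]

/-- The fluxes of the basis function `v e` out of the facets. -/
noncomputable def primalFlux [DecidableEq C] (e : E) : SubTri E → Fin 3 → ℝ :=
  (m.exists_primal_rt0 e).choose

/-- The fluxes of the field `r` with `w e = k × r` out of the facets. -/
noncomputable def dualFlux [DecidableEq V] (e : E) : SubTri E → Fin 3 → ℝ :=
  (m.exists_dual_rt0 e).choose

/-- The corner values of the basis function `gamma j`. -/
noncomputable def hat [DecidableEq V] [DecidableEq C] (j : V) : SubTri E → Fin 3 → ℝ :=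
  m.hatVals j (m.exists_hat j).choose

theorem isCompoundRT0_primalFlux [DecidableEq C] (e : E) :
    m.IsCompoundRT0 2 m.cellOf (m.vFlux e) (m.primalFlux e) :=
  (m.exists_primal_rt0 e).choose_spec

theorem isCompoundRT0_dualFlux [DecidableEq V] (e : E) :
    m.IsCompoundRT0 0 m.vertOf (m.wFlux e) (m.dualFlux e) :=
  (m.exists_dual_rt0 e).choose_spec

theorem divRT0_primalFlux [Fintype C] [DecidableEq C] (e : E) (T : SubTri E) (p : ℝ × ℝ) :
    m.divRT0 (m.primalFlux e) T = ∑ i, m.nInc e i * m.alpha i T p := by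
  rw [(m.isCompoundRT0_primalFlux e).divRT0_eq m.isFanPartition_cellOf, sum_vFlux]
  simp [alpha, cellTris, div_eq_mul_inv]

theorem divRT0_dualFlux [Fintype V] [DecidableEq V] (e : E) (T : SubTri E) (p : ℝ × ℝ) :
    m.divRT0 (m.dualFlux e) T = ∑ j, m.tInc e j * m.beta j T p := by
  rw [(m.isCompoundRT0_dualFlux e).divRT0_eq m.isFanPartition_vertOf, sum_wFlux]
  simp [beta, dualTris, div_eq_mul_inv]

variable [DecidableEq V] [DecidableEq C]

theorem sum_tInc_smul_primalFlux (j : V) :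
    ∑ e, m.tInc e j • m.primalFlux e = -rotGradFlux (m.hat j) := by
  have hprimal (e : E) : (m.vFlux e, m.primalFlux e) ∈ m.compoundRT0 2 m.cellOf :=
    m.isCompoundRT0_primalFlux e
  have hrot : (fun T => orient T * (m.hat j T 0 - m.hat j T 1), rotGradFlux (m.hat j)) ∈
      m.compoundRT0 2 m.cellOf :=
    m.isCompoundRT0_rotGradFlux (m.isContinuousP1_hatVals j _) (m.exists_hat j).choose_spec
  have hsum : ∑ e, m.tInc e j • (m.vFlux e, m.primalFlux e) +
      (fun T => orient T * (m.hat j T 0 - m.hat j T 1), rotGradFlux (m.hat j)) ∈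
      m.compoundRT0 2 m.cellOf :=
    add_mem (sum_mem fun e _ => Submodule.smul_mem _ _ (hprimal e)) hrot
  have hboundary : ∑ e, m.tInc e j • m.vFlux e +
      (fun T => orient T * (m.hat j T 0 - m.hat j T 1)) = 0 := by
    ext T
    simp [hat, sum_tInc_mul_vFlux m j (m.exists_hat j).choose T]
  simp only [Prod.smul_mk, ← prod_mk_sum, Prod.mk_add_mk, hboundary] at hsum
  exact eq_neg_of_add_eq_zero_left (IsCompoundRT0.eq_zero hsum m.isFanPartition_cellOf)

theorem sum_tInc_smul_v (j : V) (T : SubTri E) (p : ℝ × ℝ) :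
    ∑ e, m.tInc e j • m.v e T p = -m.perp T (m.gradP1 (m.hat j) T) := by
  rw [← rt0_rotGradFlux (p := p), ← rt0_neg, ← sum_tInc_smul_primalFlux, rt0_sum_smul]
  rfl

theorem sum_tInc_mul_innerV_perp (j : V) {f : SubTri E → Fin 3 → ℝ}
    (hf : m.IsNormalContinuous f) :
    ∑ e, m.tInc e j * m.innerV (m.v e) (fun T p => m.perp T (m.rt0 f T p)) =
      m.innerS (m.gamma j) (fun T _ => m.divRT0 f T) := by
  have hintegrable (e : E) (T : SubTri E) :
      IntegrableOn (fun p => m.v e T p ⬝ᵥ m.perp T (m.rt0 f T p)) refTri :=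
    integrableOn_refTri <| (m.continuous_rt0 _ T).dotProduct <|
      (m.continuous_perp T).comp (m.continuous_rt0 f T)
  have hpoint (T : SubTri E) (p : ℝ × ℝ) :
      ∑ e, m.tInc e j * (m.v e T p ⬝ᵥ m.perp T (m.rt0 f T p)) =
        -(m.gradP1 (m.hat j) T ⬝ᵥ m.rt0 f T p) := by
    simp only [← smul_eq_mul, ← smul_dotProduct, ← sum_dotProduct]
    rw [sum_tInc_smul_v, neg_dotProduct, m.perp_dot_perp (m.kvec_dot_gradP1 _ T)]
  calc ∑ e, m.tInc e j * m.innerV (m.v e) (fun T p => m.perp T (m.rt0 f T p))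
      = m.intOver Finset.univ (fun T p => -(m.gradP1 (m.hat j) T ⬝ᵥ m.rt0 f T p)) := by
        simp only [← hpoint]
        exact (m.intOver_sum_mul _ _ _ fun e _ T _ => hintegrable e T).symm
    _ = -m.innerV (fun T _ => m.gradP1 (m.hat j) T) (m.rt0 f) := by
        simp only [innerV, intOver, facetInt, integral_neg, mul_neg, Finset.sum_neg_distrib]
    _ = m.innerS (m.gamma j) (fun T _ => m.divRT0 f T) := by
        rw [innerV_gradP1_rt0 (g := m.hat j) m (m.isContinuousP1_hatVals j _) hf, neg_neg]
        rfl

end Flux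

/-! ### Matrix identities -/

section Matrices

variable [Fintype E] [DecidableEq V] [DecidableEq C]

theorem D2bar_mul_D1bar : m.D2bar * m.D1bar = 0 := by
  rw [D2bar, D1bar, Matrix.mul_neg, ← Matrix.transpose_mul, D2_mul_D1, Matrix.transpose_zero,
    neg_zero]

variable [DecidableEq E]

theorem D2bar_mul_H [Fintype V] : m.D2bar * m.H = m.J * m.D2bar := by
  ext j e
  calc (m.D2bar * m.H) j e
      = m.innerS (m.gamma j) (fun T _ => m.divRT0 (m.dualFlux e) T) :=
        m.sum_tInc_mul_innerV_perp j (m.isCompoundRT0_dualFlux e).normal_cont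
    _ = m.innerS (m.gamma j) (fun T p => ∑ j', m.tInc e j' * m.beta j' T p) := by
        simp only [innerS, ← divRT0_dualFlux]
    _ = ∑ j', m.tInc e j' * m.innerS (m.gamma j) (m.beta j') :=
        m.innerS_sum_mul _ _ (continuous_p1 _) fun _ _ _ => continuous_const
    _ = (m.J * m.D2bar) j e := Finset.sum_congr rfl fun _ _ => mul_comm _ _

theorem D2bar_mul_W [Fintype C] : m.D2bar * m.W = -(m.R * m.D2) := by
  ext j e
  have hdiv : ∑ e', m.tInc e' j * m.innerV (m.v e') (fun T p => m.perp T (m.v e T p)) =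
      ∑ i, m.nInc e i * m.innerS (m.gamma j) (m.alpha i) :=
    calc ∑ e', m.tInc e' j * m.innerV (m.v e') (fun T p => m.perp T (m.v e T p))
        = m.innerS (m.gamma j) (fun T _ => m.divRT0 (m.primalFlux e) T) :=
          m.sum_tInc_mul_innerV_perp j (m.isCompoundRT0_primalFlux e).normal_cont
      _ = m.innerS (m.gamma j) (fun T p => ∑ i, m.nInc e i * m.alpha i T p) := by
          simp only [innerS, ← divRT0_primalFlux]
      _ = ∑ i, m.nInc e i * m.innerS (m.gamma j) (m.alpha i) :=
          m.innerS_sum_mul _ _ (continuous_p1 _) fun _ _ _ => continuous_const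
  simp only [Matrix.mul_apply, Matrix.neg_apply, D2bar, D1, W, R, D2, Matrix.of_apply,
    Matrix.transpose_apply, mul_neg, Finset.sum_neg_distrib, hdiv, mul_comm]

end Matrices

/-! ### Evolution of the dual fields -/

section DualField

variable [Fintype V] [Fintype E] [DecidableEq V]

theorem dualField_eq (X : V → ℝ) (T : SubTri E) (p : ℝ × ℝ) :
    m.dualField X T p = X (m.vertOf T) * (∑ S ∈ m.dualTris (m.vertOf T), m.area S)⁻¹ := by
  simp [dualField, beta]

theorem dualField_add (X Y : V → ℝ) (T : SubTri E) (p : ℝ × ℝ) :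
    m.dualField (X + Y) T p = m.dualField X T p + m.dualField Y T p := by
  simp only [dualField_eq, Pi.add_apply, add_mul]

theorem intOver_dualTris_dualField (X : V → ℝ) (j : V) :
    m.intOver (m.dualTris j) (fun T p => m.dualField X T p) = X j := by
  have hfacet : ∀ T ∈ m.dualTris j, m.facetInt T (fun p => m.dualField X T p) =
      m.area T * (X j * (∑ S ∈ m.dualTris j, m.area S)⁻¹) := fun T hT => by
    simp only [dualField_eq, (Finset.mem_filter.1 hT).2, facetInt_const]
  obtain ⟨e, h, rfl⟩ := m.vert_surj j
  have harea : ∑ S ∈ m.dualTris (m.vert e h), m.area S ≠ 0 :=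
    (m.sum_area_pos (elem := m.vertOf) (e, h, true)).ne'
  rw [intOver, Finset.sum_congr rfl hfacet, ← Finset.sum_mul, mul_left_comm,
    mul_inv_cancel₀ harea, mul_one]

end DualField

section Evolution

variable [Fintype V] [Fintype E] [Fintype C] [DecidableEq V] [DecidableEq E] [DecidableEq C]
  {I : Set ℝ} {t : ℝ}

theorem hasDerivWithinAt_dualMass (hJ : IsUnit m.J) (ht : t ∈ I) {Phi : ℝ → C → ℝ}
    {PhiBar : ℝ → V → ℝ} {F Fhat : E → ℝ} (hPhi : HasDerivWithinAt Phi (-(m.D2 *ᵥ F)) I t)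
    (hPhiBar : ∀ r ∈ I, m.J *ᵥ PhiBar r = m.R *ᵥ Phi r) (hFhat : m.H *ᵥ Fhat = -(m.W *ᵥ F)) :
    HasDerivWithinAt PhiBar (-(m.D2bar *ᵥ Fhat)) I t := by
  refine hasDerivWithinAt_of_mulVec_eq hJ m.R ht hPhiBar hPhi ?_
  calc m.J *ᵥ -(m.D2bar *ᵥ Fhat)
      = -(m.D2bar *ᵥ (m.H *ᵥ Fhat)) := by
        rw [Matrix.mulVec_neg, Matrix.mulVec_mulVec, Matrix.mulVec_mulVec, D2bar_mul_H]
    _ = m.D2bar *ᵥ (m.W *ᵥ F) := by rw [hFhat, Matrix.mulVec_neg, neg_neg]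
    _ = m.R *ᵥ -(m.D2 *ᵥ F) := by
        rw [Matrix.mulVec_mulVec, D2bar_mul_W, Matrix.neg_mulVec, Matrix.mulVec_neg,
          Matrix.mulVec_mulVec]

theorem hasDerivWithinAt_dualVorticity (hJ : IsUnit m.J) (ht : t ∈ I) {U : ℝ → E → ℝ}
    {XiHat : ℝ → V → ℝ} {U' Q Qhat : E → ℝ} {B : C → ℝ} (hU : HasDerivWithinAt U U' I t)
    (hmomentum : m.M *ᵥ U' + m.M *ᵥ Q + m.D1bar *ᵥ B = 0)
    (hXiHat : ∀ r ∈ I, m.J *ᵥ XiHat r = m.D2bar *ᵥ (m.M *ᵥ U r)) (hQhat : m.H *ᵥ Qhat = m.M *ᵥ Q) :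
    HasDerivWithinAt XiHat (-(m.D2bar *ᵥ Qhat)) I t := by
  refine hasDerivWithinAt_of_mulVec_eq hJ m.D2bar ht hXiHat (hasDerivWithinAt_mulVec m.M hU) ?_
  have hcurl : m.D2bar *ᵥ (m.M *ᵥ U') + m.D2bar *ᵥ (m.M *ᵥ Q) = 0 := by
    have h := congrArg (m.D2bar *ᵥ ·) hmomentum
    simpa only [Matrix.mulVec_add, Matrix.mulVec_mulVec _ m.D2bar m.D1bar, D2bar_mul_D1bar,
      Matrix.zero_mulVec, add_zero, Matrix.mulVec_zero] using h
  calc m.J *ᵥ -(m.D2bar *ᵥ Qhat)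
      = -(m.D2bar *ᵥ (m.H *ᵥ Qhat)) := by
        rw [Matrix.mulVec_neg, Matrix.mulVec_mulVec, Matrix.mulVec_mulVec, D2bar_mul_H]
    _ = m.D2bar *ᵥ (m.M *ᵥ U') := by rw [hQhat, eq_neg_of_add_eq_zero_left hcurl]

end Evolution

end PolygonalMesh

theorem mainTheorem6 {V E C : Type*} [Fintype V] [Fintype E] [Fintype C]
    [DecidableEq V] [DecidableEq E] [DecidableEq C] (m : PolygonalMesh V E C) (hJ : IsUnit m.J)
    (adv1 : (E → ℝ) → (C → ℝ) → E → ℝ) (adv2 : (E → ℝ) → (V → ℝ) → E → ℝ)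
    (PhiOrog : C → ℝ) (cor : V → ℝ) (I : Set ℝ) (s : SWTrajectory V E C)
    (hs : s.Solves m adv1 adv2 PhiOrog cor I) :
    ∀ t ∈ I,
      (∃ dPhiBar, HasDerivWithinAt s.PhiBar dPhiBar I t ∧
        dPhiBar + m.D2bar *ᵥ s.FhatPerp t = 0) ∧
      (∃ dXiHat, HasDerivWithinAt s.XiHat dXiHat I t ∧
        dXiHat + m.D2bar *ᵥ s.QhatPerp t = 0) ∧
      (∀ j, HasDerivWithinAt
        (fun r => m.intOver (m.dualTris j) fun T p => m.dualField (s.PhiBar r) T p)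
        (-∑ e, m.tInc e j * s.FhatPerp t e) I t) ∧
      (∀ j, HasDerivWithinAt
        (fun r => m.intOver (m.dualTris j) fun T p =>
          m.dualField (s.PV r) T p * m.dualField (s.PhiBar r) T p)
        (-∑ e, m.tInc e j * adv2 (s.FhatPerp t) (s.PV t) e) I t) := by
  intro t ht
  obtain ⟨Phi', hPhi, hmass⟩ := hs.mass t ht
  obtain ⟨U', hU, hmomentum⟩ := hs.momentum t ht
  rw [eq_neg_of_add_eq_zero_left hmass] at hPhi
  have hPhiBar : HasDerivWithinAt s.PhiBar (-(m.D2bar *ᵥ s.FhatPerp t)) I t :=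
    m.hasDerivWithinAt_dualMass hJ ht hPhi hs.dualMass (hs.dualMassFlux t ht)
  have hXiHat : HasDerivWithinAt s.XiHat (-(m.D2bar *ᵥ s.QhatPerp t)) I t :=
    m.hasDerivWithinAt_dualVorticity hJ ht hU hmomentum
      (fun r hr => (hs.dualVorticity r hr).trans (hs.vorticity r hr)) (hs.primalPVFlux t ht)
  have hPV (j : V) (r : ℝ) (hr : r ∈ I) : m.intOver (m.dualTris j) (fun T p =>
      m.dualField (s.PV r) T p * m.dualField (s.PhiBar r) T p) = cor j + s.XiHat r j := by
    simp only [hs.pv r hr, ← m.dualField_add, m.intOver_dualTris_dualField, Pi.add_apply]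
  refine ⟨⟨_, hPhiBar, neg_add_cancel _⟩, ⟨_, hXiHat, neg_add_cancel _⟩, fun j => ?_, fun j => ?_⟩
  · simp only [m.intOver_dualTris_dualField]
    exact hasDerivWithinAt_pi.1 hPhiBar j
  · rw [← hs.pvFlux t ht]
    exact ((hasDerivWithinAt_pi.1 hXiHat j).const_add (cor j)).congr_of_mem (hPV j) ht
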